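/- Let $X=(X_1,\dots,X_d)$ be a random vector whose coordinates are partitioned into blocks $\pi_1,\dots,\pi_K$ such that $X_{\pi_1},\dots,X_{\pi_K}$ are independent and the coordinates of $X_{\pi_1}$ are mutually independent. Let $f:\mathbb R^d\to\mathbb R^N$ be measurable with (A2) $0<\mathbb E\|f(X)\|^2<\infty$ and (A3) $\mathbb E\|f(X)\|^4<\infty$. Let $u\subseteq\{1,\dots,d\}$, and for each $k\ge 2$ let $w_k=(w_{1,k},\dots,w_{d_k,k})$ be a permutation of $\pi_k$ whose first $p_k$ elements (for some $0\le p_k\le d_k$) form $u\cap\pi_k$. Let a dependency model of $X$ along these permutations be given: real random variables $Z_{w_{i,k}}$ ($k\ge2$, $i\ge 2$), independent of each other and of $X_{\pi_1}$ and the $X_{w_{1,k}}$, and measurable functions $r_{w_{i,k}}$ with, for every $k\ge2$, $$(X_{w_{1,k}},\dots,X_{w_{d_k,k}})\overset{d}{=}\big(X_{w_{1,k}},\,r_{w_{2,k}}(X_{w_{1,k}},Z_{w_{2,k}}),\dots,r_{w_{d_k,k}}(X_{w_{1,k}},Z_{w_{2,k}},\dots,Z_{w_{d_k,k}})\big).$$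 Let $E=(E_1,\dots,E_d)$ be the vector of independent variables with $E_i=X_i$ if $i\in\pi_1\cup\{w_{1,2},\dots,w_{1,K}\}$ and $E_i=Z_i$ otherwise, and let $g$ be the function of $E$ obtained from $f$ by replacing each $X_{w_{i,k}}$, $i,k\ge2$, by $r_{w_{i,k}}(X_{w_{1,k}},Z_{w_{2,k}},\dots,Z_{w_{i,k}})$. For vectors $a,b$ write $(a_u,b_{\sim u})$ for the vector with coordinates $a_i$ for $i\in u$ and $b_i$ for $i\notin u$. Put $$f^{fo}_u=\mathbb E[g(E)\mid E_u]-\mathbb E[g(E)],\qquad f^{tot}_u=g(E)-\mathbb E_{E_u}[g(E)],$$ where $\mathbb E_{E_u}$ integrates over the coordinates in $u$ only, and $$D_u=\mathbb E[f^{fo}_u (f^{fo}_u)^{\top}],\qquad D_u^{tot}=\mathbb E[f^{tot}_u (f^{tot}_u)^{\top}],\qquad \Sigma=\mathbb E[g(E)g(E)^\top]-\mathbb E[g(E)]\,\mathbb E[g(E)]^\top .$$ The first-type indices are $G^1_u=\operatorname{tr}D_u/\operatorname{tr}\Sigma$ and $G^1_{T_u}=\operatorname{tr}D_u^{tot}/\operatorname{tr}\Sigma$;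 the second-type indices are $G^2_u=\|D_u\|_F/\|\Sigma\|_F$ and $G^2_{T_u}=\|D_u^{tot}\|_F/\|\Sigma\|_F$ (Frobenius norm). A ratio with zero denominator is read as $0$, both for indices and for estimators. Let $(E_i^{(1)})_{i\ge 1}$ and $(E_i^{(2)})_{i\ge1}$ be two independent i.i.d. samples of $E$, and set $$A_i=g(E_i^{(1)})-g\big(E^{(2)}_{i,u},E^{(1)}_{i,\sim u}\big),\qquad B_i=g\big(E^{(1)}_{i,u},E^{(2)}_{i,\sim u}\big)-g(E_i^{(2)}),$$ $$K_i=A_iB_i^\top+B_iA_i^\top,\qquad K^{tot}_i=A_iA_i^\top+B_iB_i^\top,\qquad \widehat{D_u}=\frac1{4m}\sum_{i=1}^mK_i,\qquad \widehat{D_u^{tot}}=\frac1{4m}\sum_{i=1}^mK_i^{tot},$$ $$\widehat\Sigma=\frac1{2M}\sum_{i=1}^M\big[g(F_i^{(1)})-g(F_i^{(2)})\big]\big[g(F_i^{(1)})-g(F_i^{(2)})\big]^\top,$$ where $(F^{(1)}_i)_{i\ge1},(F_i^{(2)})_{i\ge1}$ are again two independent i.i.d. samples of $E$, defined on the same probability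 space, possibly equal to, or dependent in any way on, the samples $(E_i^{(1)}),(E_i^{(2)})$. Let $m\to\infty$ and $M\to\infty$. (i) First type: $$\widehat{G^1_u}:=\frac{\operatorname{tr}\widehat{D_u}}{\operatorname{tr}\widehat\Sigma}\xrightarrow{P}G^1_u,\qquad \widehat{G^1_{T_u}}:=\frac{\operatorname{tr}\widehat{D_u^{tot}}}{\operatorname{tr}\widehat\Sigma}\xrightarrow{P}G^1_{T_u}.$$ If moreover $m/M\to0$, then $$\sqrt m\big(\widehat{G^1_u}-G^1_u\big)\xrightarrow{\mathcal D}\mathcal N\Big(0,\frac{\operatorname{Var}[\operatorname{tr}K_1]}{16(\operatorname{tr}\Sigma)^2}\Big),\qquad \sqrt m\big(\widehat{G^1_{T_u}}-G^1_{T_u}\big)\xrightarrow{\mathcal D}\mathcal N\Big(0,\frac{\operatorname{Var}[\operatorname{tr}K^{tot}_1]}{16(\operatorname{tr}\Sigma)^2}\Big).$$ (ii) Second type: $$\widehat{G^2_u}:=\frac{\|\widehat{D_u}\|_F}{\|\widehat\Sigma\|_F}\xrightarrow{P}G^2_u,\qquad \widehat{G^2_{T_u}}:=\frac{\|\widehat{D_u^{tot}}\|_F}{\|\widehat\Sigma\|_F}\xrightarrow{P}G^2_{T_u}.$$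 If moreover $m/M\to0$, then, provided $D_u\ne0$ for the first and $D_u^{tot}\neq0$ for the second, $$\sqrt m\big(\widehat{G^2_u}-G^2_u\big)\xrightarrow{\mathcal D}\mathcal N\Big(0,\frac{\operatorname{vec}(D_u)^\top\operatorname{Var}[\operatorname{vec}K_1]\operatorname{vec}(D_u)}{16\|D_u\|_F^2\|\Sigma\|_F^2}\Big),$$ $$\sqrt m\big(\widehat{G^2_{T_u}}-G^2_{T_u}\big)\xrightarrow{\mathcal D}\mathcal N\Big(0,\frac{\operatorname{vec}(D^{tot}_u)^\top\operatorname{Var}[\operatorname{vec}K^{tot}_1]\operatorname{vec}(D^{tot}_u)}{16\|D^{tot}_u\|_F^2\|\Sigma\|_F^2}\Big).$$ -/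

import Mathlib

open MeasureTheory ProbabilityTheory Filter Topology

noncomputable section

namespace DepGSI

/-- The index structure attached to `d` inputs: a partition into blocks, and in every block an
ordering `w k = (w_{1,k}, …, w_{d_k,k})` of its elements (a permutation of the block). Block `0` is
the block of mutually independent inputs (the ordering of that block is never used); the blocks
`1, …, K` are the blocks of dependent inputs. -/
structure BlockOrdering (d K : ℕ) where
  block : Fin d → Fin (K + 1)
  w : (k : Fin (K + 1)) → Fin (Fintype.card {i : Fin d // block i = k}) ≃ {i : Fin d // block i = k}

namespace BlockOrdering

variable {d K : ℕ} (O : BlockOrdering d K)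

/-- The position of an input in the ordering of its own block, counted from `0`. -/
def pos (i : Fin d) : ℕ := ((O.w (O.block i)).symm ⟨i, rfl⟩ : ℕ)

/-- The inputs that are kept as they are: those of block `0` and the first one
of every dependent block. -/
def IsRoot (i : Fin d) : Prop := O.block i = 0 ∨ O.pos i = 0

instance : DecidablePred O.IsRoot := fun i =>
  inferInstanceAs (Decidable (O.block i = 0 ∨ O.pos i = 0))

/-- The inputs of the same block as `i` that do not come after `i` in the ordering. -/
abbrev Upto (i : Fin d) : Type := {j : Fin d // O.block j = O.block i ∧ O.pos j ≤ O.pos i}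

/-- The subvector of the inputs of block `k`. -/
def proj (k : Fin (K + 1)) (x : Fin d → ℝ) : {i : Fin d // O.block i = k} → ℝ := fun i => x i.1

/-- The ordering is adapted to `u`: in every dependent block, the elements of `u` are the
first `p` elements `w_{1,k}, …, w_{p,k}` for some `p` (possibly `0`). -/
def Adapted (u : Finset (Fin d)) : Prop :=
  ∀ k : Fin (K + 1), k ≠ 0 → ∃ p : ℕ, ∀ i : Fin d, O.block i = k → (i ∈ u ↔ O.pos i < p)

/-- The law `μ` of the input vector makes the blocks independent, and the inputs of
block `0` mutually independent. -/
structure BlockIndependent (μ : Measure (Fin d → ℝ)) : Prop where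
  blocks : iIndepFun (fun (k : Fin (K + 1)) (x : Fin d → ℝ) => O.proj k x) μ
  free : iIndepFun (fun (i : {i : Fin d // O.block i = 0}) (x : Fin d → ℝ) => x i.1) μ

/-- The law of the vector of independent variables: `X_i` when `i` is a root,
and the innovation `Z_i` (of law `ν i`) otherwise, all independent. -/
def indepLaw (μ : Measure (Fin d → ℝ)) (ν : Fin d → Measure ℝ) : Measure (Fin d → ℝ) :=
  Measure.pi fun i => if O.IsRoot i then μ.map (fun x => x i) else ν i

/-- From the independent variables `e` back to the inputs: a root is kept, and
`X_{w_i} = r_{w_i} (X_{w_1}, Z_{w_2}, …, Z_{w_i})` for the others. -/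
def complete (r : (i : Fin d) → (O.Upto i → ℝ) → ℝ) (e : Fin d → ℝ) : Fin d → ℝ :=
  fun i => if O.IsRoot i then e i else r i (fun j => e j.1)

end BlockOrdering

/-- A dependency model, relative to an ordering, of a random vector of law `μ`: laws `ν i` of
the innovations `Z_i` (real, independent of each other and of the roots; e.g. uniform on `(0,1)`)
and measurable triangular dependency functions such that, in every dependent block,
`(X_{w_1}, X_{w_2}, …, X_{w_{d_k}})` has the law of
`(X_{w_1}, r_{w_2}(X_{w_1}, Z_{w_2}), …, r_{w_{d_k}}(X_{w_1}, Z_{w_2}, …, Z_{w_{d_k}}))`. -/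
structure DependencyModel {d K : ℕ} (O : BlockOrdering d K) (μ : Measure (Fin d → ℝ)) where
  ν : Fin d → Measure ℝ
  isProb : ∀ i, IsProbabilityMeasure (ν i)
  r : (i : Fin d) → (O.Upto i → ℝ) → ℝ
  measurable_r : ∀ i, Measurable (r i)
  law : ∀ k : Fin (K + 1), k ≠ 0 →
    μ.map (O.proj k) = (O.indepLaw μ ν).map (fun e => O.proj k (O.complete r e))

namespace DependencyModel

variable {d K : ℕ} {O : BlockOrdering d K} {μ : Measure (Fin d → ℝ)} (D : DependencyModel O μ)

/-- The law of the vector of all the independent variables `(X_o, Z)`. -/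
def baseLaw : Measure (Fin d → ℝ) := O.indepLaw μ D.ν

/-- The equivalent representation `g` of the model `f`, a function of independent variables. -/
def repr {N : ℕ} (f : (Fin d → ℝ) → EuclideanSpace ℝ (Fin N)) (e : Fin d → ℝ) :
    EuclideanSpace ℝ (Fin N) := f (O.complete D.r e)

end DependencyModel

section Covariances

variable {d N : ℕ}

/-- The matrix `a bᵀ`. -/
def outer (a b : EuclideanSpace ℝ (Fin N)) : Matrix (Fin N) (Fin N) ℝ :=
  Matrix.of fun i j => a i * b j

/-- The entrywise expectation of a random matrix. -/
def matExp {E : Type*} [MeasurableSpace E] (Q : Measure E) (A : E → Matrix (Fin N) (Fin N) ℝ) :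
    Matrix (Fin N) (Fin N) ℝ := Matrix.of fun i j => ∫ e, A e i j ∂Q

/-- First-order sensitivity functional: `𝔼[g | e_i, i ∈ u] - 𝔼[g]`. -/
def foSF (Q : Measure (Fin d → ℝ)) (g : (Fin d → ℝ) → EuclideanSpace ℝ (Fin N))
    (u : Finset (Fin d)) (e : Fin d → ℝ) : EuclideanSpace ℝ (Fin N) :=
  (Q[g | MeasurableSpace.comap (fun (x : Fin d → ℝ) (i : u) => x i.1) inferInstance]) e
    - ∫ e', g e' ∂Q

/-- Total sensitivity functional: `g` minus its expectation taken with respect to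
the coordinates in `u` only. -/
def totSF (Q : Measure (Fin d → ℝ)) (g : (Fin d → ℝ) → EuclideanSpace ℝ (Fin N))
    (u : Finset (Fin d)) (e : Fin d → ℝ) : EuclideanSpace ℝ (Fin N) :=
  g e - ∫ e', g (u.piecewise e' e) ∂Q

/-- First-order covariance `D_u`. -/
def foCov (Q : Measure (Fin d → ℝ)) (g : (Fin d → ℝ) → EuclideanSpace ℝ (Fin N))
    (u : Finset (Fin d)) : Matrix (Fin N) (Fin N) ℝ :=
  matExp Q fun e => outer (foSF Q g u e) (foSF Q g u e)

/-- Total-effect covariance `D_u^tot`. -/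
def totCov (Q : Measure (Fin d → ℝ)) (g : (Fin d → ℝ) → EuclideanSpace ℝ (Fin N))
    (u : Finset (Fin d)) : Matrix (Fin N) (Fin N) ℝ :=
  matExp Q fun e => outer (totSF Q g u e) (totSF Q g u e)

/-- Covariance `Σ` of the outputs. -/
def outCov (Q : Measure (Fin d → ℝ)) (g : (Fin d → ℝ) → EuclideanSpace ℝ (Fin N)) :
    Matrix (Fin N) (Fin N) ℝ :=
  matExp Q (fun e => outer (g e) (g e)) - outer (∫ e, g e ∂Q) (∫ e, g e ∂Q)

open scoped Matrix.Norms.Frobenius in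
/-- The Frobenius norm of a matrix. -/
def frob (A : Matrix (Fin N) (Fin N) ℝ) : ℝ := ‖A‖

/-- The first-type ratio (traces). -/
def ratio1 (A S : Matrix (Fin N) (Fin N) ℝ) : ℝ := A.trace / S.trace

/-- The second-type ratio (Frobenius norms). -/
def ratio2 (A S : Matrix (Fin N) (Fin N) ℝ) : ℝ := frob A / frob S

/-- `g(e¹) - g(e²_u, e¹_{∼u})`. -/
def diffA (g : (Fin d → ℝ) → EuclideanSpace ℝ (Fin N)) (u : Finset (Fin d))
    (e₁ e₂ : Fin d → ℝ) : EuclideanSpace ℝ (Fin N) := g e₁ - g (u.piecewise e₂ e₁)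

/-- `g(e¹_u, e²_{∼u}) - g(e²)`. -/
def diffB (g : (Fin d → ℝ) → EuclideanSpace ℝ (Fin N)) (u : Finset (Fin d))
    (e₁ e₂ : Fin d → ℝ) : EuclideanSpace ℝ (Fin N) := g (u.piecewise e₁ e₂) - g e₂

/-- The kernel `K` of the first-order covariance. -/
def kerFo (g : (Fin d → ℝ) → EuclideanSpace ℝ (Fin N)) (u : Finset (Fin d))
    (e₁ e₂ : Fin d → ℝ) : Matrix (Fin N) (Fin N) ℝ :=
  outer (diffA g u e₁ e₂) (diffB g u e₁ e₂) + outer (diffB g u e₁ e₂) (diffA g u e₁ e₂)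

/-- The kernel `K^tot` of the total-effect covariance. -/
def kerTot (g : (Fin d → ℝ) → EuclideanSpace ℝ (Fin N)) (u : Finset (Fin d))
    (e₁ e₂ : Fin d → ℝ) : Matrix (Fin N) (Fin N) ℝ :=
  outer (diffA g u e₁ e₂) (diffA g u e₁ e₂) + outer (diffB g u e₁ e₂) (diffB g u e₁ e₂)

end Covariances

section Estimators

variable {Ω : Type*} [MeasurableSpace Ω] {d N : ℕ}

/-- `S 0` and `S 1` are two independent i.i.d. samples of law `Q`. -/
structure IsDoubleSample (P : Measure Ω) (Q : Measure (Fin d → ℝ))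
    (S : Fin 2 → ℕ → Ω → Fin d → ℝ) : Prop where
  indep : iIndepFun (fun (p : Fin 2 × ℕ) => S p.1 p.2) P
  law : ∀ j i, HasLaw (S j i) Q P

/-- The estimator `(4m)⁻¹ ∑_{i<m} K(𝒳_i)` of `D_u`. -/
def foCovEst (g : (Fin d → ℝ) → EuclideanSpace ℝ (Fin N)) (u : Finset (Fin d))
    (S : Fin 2 → ℕ → Ω → Fin d → ℝ) (m : ℕ) (ω : Ω) : Matrix (Fin N) (Fin N) ℝ :=
  (1 / (4 * (m : ℝ))) • ∑ i ∈ Finset.range m, kerFo g u (S 0 i ω) (S 1 i ω)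

/-- The estimator `(4m)⁻¹ ∑_{i<m} K^tot(𝒳_i)` of `D_u^tot`. -/
def totCovEst (g : (Fin d → ℝ) → EuclideanSpace ℝ (Fin N)) (u : Finset (Fin d))
    (S : Fin 2 → ℕ → Ω → Fin d → ℝ) (m : ℕ) (ω : Ω) : Matrix (Fin N) (Fin N) ℝ :=
  (1 / (4 * (m : ℝ))) • ∑ i ∈ Finset.range m, kerTot g u (S 0 i ω) (S 1 i ω)

/-- The estimator of `Σ` from two samples of size `M`. -/
def outCovEst (g : (Fin d → ℝ) → EuclideanSpace ℝ (Fin N))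
    (S : Fin 2 → ℕ → Ω → Fin d → ℝ) (M : ℕ) (ω : Ω) : Matrix (Fin N) (Fin N) ℝ :=
  (1 / (2 * (M : ℝ))) • ∑ i ∈ Finset.range M,
    outer (g (S 0 i ω) - g (S 1 i ω)) (g (S 0 i ω) - g (S 1 i ω))

/-- The covariance matrix `Var[vec A]` of the vectorization of a random matrix. -/
def varVec (P : Measure Ω) (A : Ω → Matrix (Fin N) (Fin N) ℝ) :
    Matrix (Fin N × Fin N) (Fin N × Fin N) ℝ :=
  Matrix.of fun a b => cov[fun ω => (A ω).vec a, fun ω => (A ω).vec b; P]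

/-- Asymptotic normality: the real random variables `T n` converge in distribution to a centred
Gaussian of variance `v`. -/
def AsympNormal (P : Measure Ω) [IsProbabilityMeasure P] (T : ℕ → Ω → ℝ) (v : ℝ) : Prop :=
  TendstoInDistribution T atTop (id : ℝ → ℝ) (fun _ => P) (gaussianReal 0 v.toNNReal)

/-- Convergence in probability to a constant. -/
def ConvInProb (P : Measure Ω) (T : ℕ → Ω → ℝ) (c : ℝ) : Prop :=
  TendstoInMeasure P T atTop (fun _ => c)

end Estimators

end DepGSI

end

/-! The dependency model rebuilds every block of inputs from independent variables with the correct
law, and distinct blocks use distinct variables, so `g(E)` has the law of `f(X)`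
(`DependencyModel.map_complete`). The fourth moment therefore passes to `g`, and from then on only a
function of independent coordinates is studied.

The three estimators are empirical means, over i.i.d. pairs `(E¹, E²)`, of the kernels `K/4`,
`K^tot/4` and `(g(E¹)-g(E²))(g(E¹)-g(E²))ᵀ/2`. Fourth moments make them square integrable. They are
unbiased by two facts. Exchanging the `u`-coordinates of two independent copies gives again two
independent copies; and two copies sharing exactly the coordinates in `u` satisfy `𝔼[a b] = 𝔼[𝔼[a|u]
𝔼[b|u]]`. Expanding the products of differences then yields the covariances.

Consistency is the law of large numbers with continuous mapping. For normality, the numerator obeys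
a scalar central limit theorem: directly for the trace, and for the Frobenius norm through `‖A‖-‖C‖
= (2⟨C,A-C⟩ + ‖A-C‖²)/(‖A‖+‖C‖)`. Chebyshev and `m/M → 0` make the error of the denominator
negligible at rate `√m`, so Slutsky's theorem applies whatever the dependence between the two double
samples. If `tr Σ = 0`, then `g` is almost surely constant, the denominators vanish almost surely,
and all ratios are `0`. -/

noncomputable section

namespace DepGSI

/-! ### Convergence in probability, Slutsky's theorem and the delta method for quotients -/

section Convergence

variable {Ω : Type*} [MeasurableSpace Ω] {P : Measure Ω} [IsProbabilityMeasure P]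

/-- Continuous mapping theorem for convergence in probability to a constant. -/
lemma tendstoInMeasure_comp_of_continuousAt {E F : Type*} [SeminormedAddCommGroup E]
    [SeminormedAddCommGroup F] {X : ℕ → Ω → E} {c : E} {φ : E → F}
    (hX : TendstoInMeasure P X atTop fun _ => c) (hφ : ContinuousAt φ c) :
    TendstoInMeasure P (fun n ω => φ (X n ω)) atTop fun _ => φ c := by
  rw [tendstoInMeasure_iff_measureReal_dist] at hX ⊢
  intro ε hε
  obtain ⟨δ, hδ, h⟩ := Metric.continuousAt_iff.1 hφ ε hε
  refine squeeze_zero (fun _ => measureReal_nonneg) (fun n => measureReal_mono ?_) (hX δ hδ)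
  intro ω hω
  simp only [Set.mem_ofPred_eq] at hω ⊢
  by_contra hlt
  exact absurd (h (not_le.1 hlt)) (not_lt.2 hω)

lemma tendstoInMeasure_pi {ι : Type*} [Fintype ι] {X : ℕ → Ω → ι → ℝ} {c : ι → ℝ}
    (hX : ∀ i, TendstoInMeasure P (fun n ω => X n ω i) atTop fun _ => c i) :
    TendstoInMeasure P X atTop fun _ => c := by
  simp_rw [tendstoInMeasure_iff_measureReal_dist] at hX ⊢
  intro ε hε
  have hsum : Tendsto (fun n => ∑ i, P.real {ω | ε ≤ dist (X n ω i) (c i)}) atTop (𝓝 0) := by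
    simpa using tendsto_finsetSum Finset.univ fun i _ => hX i ε hε
  refine squeeze_zero (fun _ => measureReal_nonneg) (fun n => ?_) hsum
  refine (measureReal_mono ?_).trans (measureReal_iUnion_fintype_le _)
  intro ω hω
  simp only [Set.mem_ofPred_eq, Set.mem_iUnion] at hω ⊢
  by_contra! hlt
  exact absurd ((dist_pi_lt_iff hε).2 hlt) (not_lt.2 hω)

lemma tendstoInMeasure_prodMk {E F : Type*} [SeminormedAddCommGroup E]
    [SeminormedAddCommGroup F] {X : ℕ → Ω → E} {Y : ℕ → Ω → F} {a : E} {b : F}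
    (hX : TendstoInMeasure P X atTop fun _ => a) (hY : TendstoInMeasure P Y atTop fun _ => b) :
    TendstoInMeasure P (fun n ω => (X n ω, Y n ω)) atTop fun _ => (a, b) := by
  rw [tendstoInMeasure_iff_measureReal_dist] at hX hY ⊢
  intro ε hε
  refine squeeze_zero (fun _ => measureReal_nonneg) (fun n => ?_)
    (by simpa using (hX ε hε).add (hY ε hε))
  refine (measureReal_mono ?_).trans (measureReal_union_le _ _)
  intro ω hω
  simpa [Prod.dist_eq] using hω

lemma tendstoInMeasure_zero_of_abs_le {X Y : ℕ → Ω → ℝ}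
    (hX : TendstoInMeasure P X atTop fun _ => (0 : ℝ)) (h : ∀ n ω, |Y n ω| ≤ |X n ω|) :
    TendstoInMeasure P Y atTop fun _ => (0 : ℝ) := by
  rw [tendstoInMeasure_iff_measureReal_norm] at hX ⊢
  intro ε hε
  refine squeeze_zero (fun _ => measureReal_nonneg) (fun n => measureReal_mono ?_) (hX ε hε)
  intro ω hω
  simp only [Set.mem_ofPred_eq, sub_zero, Real.norm_eq_abs] at hω ⊢
  exact hω.trans (h n ω)

lemma tendstoInMeasure_mul {X Y : ℕ → Ω → ℝ} {a b : ℝ}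
    (hX : TendstoInMeasure P X atTop fun _ => a) (hY : TendstoInMeasure P Y atTop fun _ => b) :
    TendstoInMeasure P (fun n ω => X n ω * Y n ω) atTop fun _ => a * b :=
  tendstoInMeasure_comp_of_continuousAt (X := fun n ω => (X n ω, Y n ω)) (c := (a, b))
    (φ := fun p : ℝ × ℝ => p.1 * p.2) (tendstoInMeasure_prodMk hX hY)
    (continuous_fst.mul continuous_snd).continuousAt

lemma tendstoInMeasure_div {X Y : ℕ → Ω → ℝ} {a b : ℝ} (hb : b ≠ 0)
    (hX : TendstoInMeasure P X atTop fun _ => a) (hY : TendstoInMeasure P Y atTop fun _ => b) :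
    TendstoInMeasure P (fun n ω => X n ω / Y n ω) atTop fun _ => a / b :=
  tendstoInMeasure_comp_of_continuousAt (X := fun n ω => (X n ω, Y n ω)) (c := (a, b))
    (φ := fun p : ℝ × ℝ => p.1 / p.2) (tendstoInMeasure_prodMk hX hY)
    (continuousAt_fst.div continuousAt_snd hb)

/-- `AsympNormal` fixes one representative of the Gaussian limit; convergence in distribution sees
only the law of the limit, so any other representative will do. -/
lemma asympNormal_of_map_eq {Ω' : Type*} [MeasurableSpace Ω'] {P' : Measure Ω'}
    [IsProbabilityMeasure P'] {T : ℕ → Ω → ℝ} {Z : Ω' → ℝ} {v : ℝ}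
    (h : TendstoInDistribution T atTop Z (fun _ => P) P')
    (hZ : P'.map Z = gaussianReal 0 v.toNNReal) : AsympNormal P T v := by
  refine ⟨h.forall_aemeasurable, by fun_prop, ?_⟩
  have e : (⟨P'.map Z, Measure.isProbabilityMeasure_map h.aemeasurable_limit⟩ :
      ProbabilityMeasure ℝ) = ⟨(gaussianReal 0 v.toNNReal).map id,
        Measure.isProbabilityMeasure_map (by fun_prop)⟩ := Subtype.ext (by simp [hZ])
  exact e ▸ h.tendsto

lemma AsympNormal.congr {T T' : ℕ → Ω → ℝ} {v : ℝ} (h : AsympNormal P T v)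
    (hT : ∀ n, T n =ᵐ[P] T' n) : AsympNormal P T' v :=
  TendstoInDistribution.congr hT EventuallyEq.rfl h

/-- Slutsky's theorem: multiplication by a factor converging in probability and addition of
a negligible term. -/
lemma AsympNormal.mul_add {T C R : ℕ → Ω → ℝ} {v c : ℝ} (h : AsympNormal P T v)
    (hC : TendstoInMeasure P C atTop fun _ => c) (hR : TendstoInMeasure P R atTop fun _ => (0 : ℝ))
    (hCm : ∀ n, AEMeasurable (C n) P) (hRm : ∀ n, AEMeasurable (R n) P) :
    AsympNormal P (fun n ω => T n ω * C n ω + R n ω) (c ^ 2 * v) := by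
  have key := TendstoInDistribution.continuous_comp_prodMk_of_tendstoInMeasure_const
    (g := fun p : ℝ × (ℝ × ℝ) => p.1 * p.2.1 + p.2.2) (by fun_prop) h
    (tendstoInMeasure_prodMk hC hR) (fun n => (hCm n).prodMk (hRm n))
  refine asympNormal_of_map_eq key ?_
  simp only [id, add_zero]
  have : (fun ω : ℝ => ω * c) = fun ω => c * ω := by ext; ring
  rw [this, gaussianReal_map_const_mul, mul_zero]
  congr 1
  apply NNReal.eq
  simp only [NNReal.coe_mul, Real.coe_toNNReal', NNReal.coe_mk]
  -- No sign is assumed on `v`: `toNNReal` truncates at `0`, which commutes with multiplication by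
  -- `c ^ 2`.
  rw [mul_max_of_nonneg _ _ (sq_nonneg c), mul_zero]

/-- For the degenerate case of zero output variance: `N(0, 0)` is the Dirac mass at `0`. -/
lemma asympNormal_zero_of_ae_eq_zero {T : ℕ → Ω → ℝ} (hT : ∀ n, T n =ᵐ[P] 0) :
    AsympNormal P T 0 := by
  have h : TendstoInDistribution (fun _ : ℕ => fun _ : Ω => (0 : ℝ)) atTop (fun _ : Ω => (0 : ℝ))
      (fun _ => P) P := tendstoInDistribution_const aemeasurable_const
  refine asympNormal_of_map_eq (TendstoInDistribution.congr (fun n => (hT n).symm)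
    EventuallyEq.rfl h) ?_
  simp [Measure.map_const]

/-- Delta method for a quotient whose denominator has a faster rate of convergence. -/
lemma AsympNormal.div {A B : ℕ → Ω → ℝ} {q : ℕ → ℝ} {a b v : ℝ} (hb : b ≠ 0)
    (hA : AsympNormal P (fun n ω => q n * (A n ω - a)) v)
    (hBa : TendstoInMeasure P B atTop fun _ => b)
    (hB : TendstoInMeasure P (fun n ω => q n * (B n ω - b)) atTop fun _ => (0 : ℝ))
    (hBm : ∀ n, AEMeasurable (B n) P) :
    AsympNormal P (fun n ω => q n * (A n ω / B n ω - a / b)) (v / b ^ 2) := by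
  have hinv : TendstoInMeasure P (fun n ω => (B n ω)⁻¹) atTop fun _ => b⁻¹ :=
    tendstoInMeasure_comp_of_continuousAt (φ := fun x : ℝ => x⁻¹) hBa
      (by fun_prop (disch := exact hb))
  -- The splitting is `q(A/B - a/b) = q(A - a)·B⁻¹ + a·q(B⁻¹ - b⁻¹)`; this is its second term.
  have hR : TendstoInMeasure P (fun n ω => a * (q n * ((B n ω)⁻¹ - b⁻¹))) atTop
      fun _ => (0 : ℝ) := by
    have h0 : TendstoInMeasure P (fun n ω => q n * ((B n ω)⁻¹ - b⁻¹)) atTop fun _ => (0 : ℝ) := by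
      rw [tendstoInMeasure_iff_measureReal_norm] at hBa hB ⊢
      intro ε hε
      have hb' : 0 < |b| := abs_pos.2 hb
      -- Where `|B - b| < |b|/2` one has `|B b| > b²/2`, so `|q (B - b)| < ε b²/2` forces `|q (B⁻¹ -
      -- b⁻¹)| < ε`.
      refine squeeze_zero (fun _ => measureReal_nonneg) (fun n => ?_)
        (by simpa using (hBa (|b| / 2) (by positivity)).add (hB (ε * b ^ 2 / 2) (by positivity)))
      refine (measureReal_mono ?_).trans (measureReal_union_le _ _)
      intro ω hω
      simp only [Set.mem_ofPred_eq, Set.mem_union, sub_zero, Real.norm_eq_abs] at hω ⊢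
      by_contra! hlt
      obtain ⟨h1, h2⟩ := hlt
      have h3 : |b| / 2 < |B n ω| := by
        have := abs_sub_abs_le_abs_sub b (B n ω)
        rw [abs_sub_comm] at this
        linarith
      have hB0 : B n ω ≠ 0 := abs_pos.1 (by linarith)
      have h4 : q n * ((B n ω)⁻¹ - b⁻¹) = -(q n * (B n ω - b)) / (B n ω * b) := by
        field_simp
        ring
      rw [← abs_mul] at h2
      rw [h4, abs_div, abs_neg, abs_mul (B n ω), le_div_iff₀ (by positivity)] at hω
      have h5 : ε * (|b| / 2 * |b|) ≤ ε * (|B n ω| * |b|) := by gcongr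
      have h6 : |b| * |b| = b ^ 2 := by rw [← sq, sq_abs]
      nlinarith
    simpa using tendstoInMeasure_comp_of_continuousAt (φ := fun x : ℝ => a * x) h0 (by fun_prop)
  have key := hA.mul_add hinv hR (fun n => (hBm n).inv)
    (fun n => (((hBm n).inv.sub_const _).const_mul _).const_mul _)
  have hv : (b⁻¹) ^ 2 * v = v / b ^ 2 := by field_simp
  rw [hv] at key
  refine key.congr fun n => Eventually.of_forall fun ω => ?_
  simp only [div_eq_mul_inv]
  ring

end Convergence

/-! ### Grouping independent variables along the fibres of a map -/

section Grouping

variable {ι κ : Type*} [Fintype ι] [Fintype κ] [DecidableEq κ] (b : ι → κ)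

/-- Grouping the coordinates of a vector along the fibres of `b`. -/
def groupCoord (α : Type*) [MeasurableSpace α] :
    (ι → α) ≃ᵐ ((k : κ) → {i : ι // b i = k} → α) where
  toFun x k i := x i.1
  invFun y i := y (b i) ⟨i, rfl⟩
  left_inv x := rfl
  right_inv y := by
    ext k ⟨i, rfl⟩
    rfl
  measurable_toFun := by
    change Measurable fun (x : ι → α) k (i : {i : ι // b i = k}) => x i.1
    fun_prop
  measurable_invFun := by
    change Measurable fun (y : (k : κ) → {i : ι // b i = k} → α) i => y (b i) ⟨i, rfl⟩
    fun_prop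

lemma map_groupCoord_pi {α : Type*} [MeasurableSpace α] (q : ι → Measure α)
    [∀ i, IsProbabilityMeasure (q i)] :
    (Measure.pi q).map (groupCoord b α) =
      Measure.pi fun k => Measure.pi fun i : {i : ι // b i = k} => q i.1 := by
  -- Passing to the inverse map leaves only boxes of the ungrouped space to test, and these
  -- determine `Measure.pi q`.
  apply (groupCoord b α).symm.map_measurableEquiv_injective
  rw [MeasurableEquiv.map_symm_map]
  apply Measure.pi_eq
  intro s hs
  rw [(groupCoord b α).symm.map_apply]
  have : (groupCoord b α).symm ⁻¹' Set.univ.pi s =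
      Set.univ.pi fun k => Set.univ.pi fun i : {i : ι // b i = k} => s i.1 := by
    ext y
    simp only [Set.mem_preimage, Set.mem_univ_pi]
    constructor
    · rintro h k ⟨i, rfl⟩
      exact h i
    · intro h i
      exact h (b i) ⟨i, rfl⟩
  rw [this, Measure.pi_pi]
  simp_rw [Measure.pi_pi]
  exact Fintype.prod_fiberwise b fun i => q i (s i)

/-- The joint law of the groups is a regrouped product measure, hence a product of products, and
each inner product is the law of one group. -/
lemma iIndepFun_group {Ω α : Type*} [MeasurableSpace Ω] [MeasurableSpace α] {P : Measure Ω}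
    {X : ι → Ω → α} (h : iIndepFun X P) (hX : ∀ i, AEMeasurable (X i) P) :
    iIndepFun (fun (k : κ) ω (i : {i : ι // b i = k}) => X i.1 ω) P := by
  have := h.isProbabilityMeasure
  have hp : ∀ i, IsProbabilityMeasure (P.map (X i)) := fun i => Measure.isProbabilityMeasure_map
    (hX i)
  have hl := h.map_fun_eq_pi_map hX
  refine (iIndepFun_iff_map_fun_eq_pi_map (β := fun k => {i : ι // b i = k} → α)
    (f := fun k ω i => X i.1 ω) (fun k => aemeasurable_pi_lambda _ fun i => hX i.1)).2 ?_
  have hXm : AEMeasurable (fun ω i => X i ω) P := aemeasurable_pi_lambda _ hX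
  have e : (fun ω (k : κ) (i : {i : ι // b i = k}) => X i.1 ω) =
      groupCoord b α ∘ fun ω i => X i ω := rfl
  rw [e, ← AEMeasurable.map_map_of_aemeasurable (by fun_prop) hXm, hl, map_groupCoord_pi]
  congr 1
  ext1 k
  symm
  exact (h.precomp (g := fun i : {i : ι // b i = k} => i.1) Subtype.val_injective).map_fun_eq_pi_map
    fun i => hX i.1

end Grouping

/-! ### Limit theorems for empirical means over a double sample -/

section Samples

variable {Ω : Type*} [MeasurableSpace Ω] {P : Measure Ω} {d : ℕ}
  {Q : Measure (Fin d → ℝ)} {S : Fin 2 → ℕ → Ω → Fin d → ℝ}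

lemma IsDoubleSample.aemeasurable (hS : IsDoubleSample P Q S) (j : Fin 2) (i : ℕ) :
    AEMeasurable (S j i) P := (hS.law j i).aemeasurable

lemma IsDoubleSample.iIndepFun_pair (hS : IsDoubleSample P Q S) :
    iIndepFun (fun i ω => (S 0 i ω, S 1 i ω)) P := by
  -- Independence is tested on finite subfamilies; this makes the index type `Fin 2 × s` finite, as
  -- `iIndepFun_group` requires.
  rw [iIndepFun_iff_finset]
  intro s
  have h := hS.indep.precomp (g := fun p : Fin 2 × s => (p.1, p.2.1)) (by
    intro p p' h
    exact Prod.ext (Prod.ext_iff.1 h).1 (Subtype.ext (Prod.ext_iff.1 h).2))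
  have h2 := iIndepFun_group (fun p : Fin 2 × s => p.2) h fun p => hS.aemeasurable _ _
  exact h2.comp (fun k y => (y ⟨(0, k), rfl⟩, y ⟨(1, k), rfl⟩)) fun k => by fun_prop

variable {φ : (Fin d → ℝ) × (Fin d → ℝ) → ℝ}

/-- The empirical mean of `φ` over the first `n` pairs of the double sample. -/
def pairMean (S : Fin 2 → ℕ → Ω → Fin d → ℝ) (φ : (Fin d → ℝ) × (Fin d → ℝ) → ℝ) (n : ℕ) (ω : Ω) :
    ℝ := (n : ℝ)⁻¹ * ∑ i ∈ Finset.range n, φ (S 0 i ω, S 1 i ω)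

lemma IsDoubleSample.iIndepFun_comp (hS : IsDoubleSample P Q S) (hφ : Measurable φ) :
    iIndepFun (fun i ω => φ (S 0 i ω, S 1 i ω)) P :=
  hS.iIndepFun_pair.comp (fun _ => φ) fun _ => hφ

variable [IsProbabilityMeasure P]

lemma IsDoubleSample.hasLaw_pair (hS : IsDoubleSample P Q S) (i : ℕ) :
    HasLaw (fun ω => (S 0 i ω, S 1 i ω)) (Q.prod Q) P :=
  IndepFun.hasLaw_prod (hS.law 0 i) (hS.law 1 i)
    (hS.indep.indepFun (i := (0, i)) (j := (1, i)) (by simp))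

lemma IsDoubleSample.hasLaw_comp (hS : IsDoubleSample P Q S) (hφ : Measurable φ) (i : ℕ) :
    HasLaw (fun ω => φ (S 0 i ω, S 1 i ω)) ((Q.prod Q).map φ) P :=
  HasLaw.fun_comp ⟨hφ.aemeasurable, rfl⟩ (hS.hasLaw_pair i)

lemma IsDoubleSample.identDistrib_comp (hS : IsDoubleSample P Q S) (hφ : Measurable φ) (i j : ℕ) :
    IdentDistrib (fun ω => φ (S 0 i ω, S 1 i ω)) (fun ω => φ (S 0 j ω, S 1 j ω)) P P :=
  ⟨(hS.hasLaw_comp hφ i).aemeasurable, (hS.hasLaw_comp hφ j).aemeasurable, by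
    rw [(hS.hasLaw_comp hφ i).map_eq, (hS.hasLaw_comp hφ j).map_eq]⟩

lemma IsDoubleSample.integral_comp (hS : IsDoubleSample P Q S) (hφ : Measurable φ) (i : ℕ) :
    ∫ ω, φ (S 0 i ω, S 1 i ω) ∂P = ∫ p, φ p ∂Q.prod Q :=
  (hS.hasLaw_pair i).integral_comp hφ.aestronglyMeasurable

lemma IsDoubleSample.memLp_comp (hS : IsDoubleSample P Q S) {p : ENNReal}
    (hφ2 : MemLp φ p (Q.prod Q)) (i : ℕ) : MemLp (fun ω => φ (S 0 i ω, S 1 i ω)) p P := by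
  have h := hS.hasLaw_pair i
  rw [← h.map_eq] at hφ2
  exact hφ2.comp_of_map h.aemeasurable

lemma IsDoubleSample.aemeasurable_pairMean (hS : IsDoubleSample P Q S) (hφ : Measurable φ) (n : ℕ) :
    AEMeasurable (pairMean S φ n) P :=
  (Finset.aemeasurable_fun_sum _ fun i _ => (hS.hasLaw_comp hφ i).aemeasurable).const_mul _

lemma IsDoubleSample.tendsto_pairMean (hS : IsDoubleSample P Q S) (hφ : Measurable φ)
    (hφ1 : Integrable φ (Q.prod Q)) {m : ℕ → ℕ} (hm : Tendsto m atTop atTop) :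
    TendstoInMeasure P (fun n => pairMean S φ (m n)) atTop fun _ => ∫ p, φ p ∂Q.prod Q := by
  have h := strong_law_ae (fun i ω => φ (S 0 i ω, S 1 i ω))
    (memLp_one_iff_integrable.1 (hS.memLp_comp (memLp_one_iff_integrable.2 hφ1) 0))
    (fun i j hij => (hS.iIndepFun_comp hφ).indepFun hij) fun i => hS.identDistrib_comp hφ i 0
  refine tendstoInMeasure_of_tendsto_ae
    (fun n => (hS.aemeasurable_pairMean hφ (m n)).aestronglyMeasurable) ?_
  filter_upwards [h] with ω hω
  rw [hS.integral_comp hφ] at hω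
  exact hω.comp hm

lemma IsDoubleSample.asympNormal_pairMean (hS : IsDoubleSample P Q S) (hφ : Measurable φ)
    (hφ2 : MemLp φ 2 (Q.prod Q)) {m : ℕ → ℕ} (hm : Tendsto m atTop atTop) :
    AsympNormal P (fun n ω => √(m n : ℝ) * (pairMean S φ (m n) ω - ∫ p, φ p ∂Q.prod Q))
      Var[fun ω => φ (S 0 0 ω, S 1 0 ω); P] := by
  have h := tendstoInDistribution_inv_sqrt_mul_sum_sub
    (X := fun i ω => φ (S 0 i ω, S 1 i ω)) (P := P) HasLaw.id (hS.memLp_comp hφ2 0)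
    (hS.iIndepFun_comp hφ) fun i => hS.identDistrib_comp hφ i 0
  have h' : AsympNormal P (fun n ω => (√(m n : ℝ))⁻¹ * (∑ k ∈ Finset.range (m n),
      φ (S 0 k ω, S 1 k ω) - (m n : ℝ) * ∫ p, φ p ∂Q.prod Q))
      Var[fun ω => φ (S 0 0 ω, S 1 0 ω); P] := by
    rw [hS.integral_comp hφ] at h
    exact ⟨fun n => h.forall_aemeasurable (m n), by fun_prop, h.tendsto.comp hm⟩
  refine h'.congr fun n => Eventually.of_forall fun ω => ?_
  simp only [pairMean]
  -- An empty sample makes both sides `0`; otherwise `√m · m⁻¹ = (√m)⁻¹`.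
  rcases Nat.eq_zero_or_pos (m n) with h0 | h0
  · simp [h0]
  · have h1 : (0 : ℝ) < m n := by exact_mod_cast h0
    have h2 : √(m n : ℝ) ≠ 0 := (Real.sqrt_pos.2 h1).ne'
    have h3 : √(m n : ℝ) * √(m n : ℝ) = m n := Real.mul_self_sqrt h1.le
    field_simp
    rw [sq, h3]

/-- Chebyshev: the error of the empirical mean is negligible at every rate slower than the
square root of the sample size. -/
lemma IsDoubleSample.tendsto_mul_pairMean_sub (hS : IsDoubleSample P Q S) (hφ : Measurable φ)
    (hφ2 : MemLp φ 2 (Q.prod Q)) {M : ℕ → ℕ} (hM : Tendsto M atTop atTop) {q : ℕ → ℝ}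
    (hq : Tendsto (fun n => q n ^ 2 / (M n : ℝ)) atTop (𝓝 0)) :
    TendstoInMeasure P (fun n ω => q n * (pairMean S φ (M n) ω - ∫ p, φ p ∂Q.prod Q)) atTop
      fun _ => (0 : ℝ) := by
  rw [tendstoInMeasure_iff_measureReal_norm]
  intro ε hε
  set V := Var[fun ω => φ (S 0 0 ω, S 1 0 ω); P] with hV
  have hlim : Tendsto (fun n => V / ε ^ 2 * (q n ^ 2 / (M n : ℝ))) atTop (𝓝 0) := by
    simpa using hq.const_mul (V / ε ^ 2)
  refine squeeze_zero' (Eventually.of_forall fun _ => measureReal_nonneg) ?_ hlim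
  -- The empty mean is `0`, hence not unbiased in general. For `M n > 0` the variance of `q · mean`
  -- is `V q²/M`, whence the Chebyshev bound in `hlim`.
  filter_upwards [hM.eventually_gt_atTop 0] with n hn
  have hn' : (0 : ℝ) < M n := by exact_mod_cast hn
  set Y : Ω → ℝ := fun ω => q n * pairMean S φ (M n) ω with hY
  have hmem : MemLp (∑ i ∈ Finset.range (M n), fun ω => φ (S 0 i ω, S 1 i ω)) 2 P :=
    memLp_finsetSum' _ fun i _ => hS.memLp_comp hφ2 i
  have hYe : Y = fun ω => (q n * (M n : ℝ)⁻¹) *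
      (∑ i ∈ Finset.range (M n), fun ω => φ (S 0 i ω, S 1 i ω)) ω := by
    ext ω
    simp [hY, pairMean, mul_assoc]
  have hYm : MemLp Y 2 P := by
    rw [hYe]
    exact hmem.const_mul _
  have hYint : ∫ ω, Y ω ∂P = q n * ∫ p, φ p ∂Q.prod Q := by
    simp only [hY, pairMean]
    rw [integral_const_mul, integral_const_mul, integral_finsetSum]
    · simp_rw [hS.integral_comp hφ]
      rw [Finset.sum_const, Finset.card_range, nsmul_eq_mul, inv_mul_cancel_left₀ hn'.ne']
    · exact fun i _ => (hS.memLp_comp hφ2 i).integrable (by norm_num)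
  have hYv : Var[Y; P] = V * (q n ^ 2 / M n) := by
    rw [hYe, variance_const_mul, IndepFun.variance_sum (fun i _ => hS.memLp_comp hφ2 i)
      (fun i _ j _ hij => (hS.iIndepFun_comp hφ).indepFun hij)]
    rw [Finset.sum_congr rfl fun i _ => (hS.identDistrib_comp hφ i 0).variance_eq]
    simp only [Finset.sum_const, Finset.card_range, nsmul_eq_mul, ← hV]
    field_simp
  have hch := meas_ge_le_variance_div_sq hYm hε
  rw [hYint, hYv] at hch
  have hset : {ω | ε ≤ ‖q n * (pairMean S φ (M n) ω - ∫ p, φ p ∂Q.prod Q) - 0‖} =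
      {ω | ε ≤ |Y ω - q n * ∫ p, φ p ∂Q.prod Q|} := by
    ext ω
    simp [hY, mul_sub]
  rw [hset, measureReal_def]
  refine (ENNReal.toReal_mono ENNReal.ofReal_ne_top hch).trans (le_of_eq ?_)
  have hV0 : 0 ≤ V := variance_nonneg _ _
  rw [ENNReal.toReal_ofReal (by positivity)]
  ring

end Samples

/-! ### Trace, Frobenius norm and linear functionals of matrices -/

section MatrixStatistics

variable {N : ℕ}

/-- The linear functional `A ↦ ∑ᵢⱼ Wᵢⱼ Aᵢⱼ` on matrices. -/
def entrySum (W A : Matrix (Fin N) (Fin N) ℝ) : ℝ := ∑ p : Fin N × Fin N, W p.1 p.2 * A p.1 p.2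

lemma entrySum_one (A : Matrix (Fin N) (Fin N) ℝ) : entrySum 1 A = A.trace := by
  simp [entrySum, Fintype.sum_prod_type, Matrix.one_apply, Matrix.trace]

lemma frob_eq_sqrt (A : Matrix (Fin N) (Fin N) ℝ) :
    frob A = √(∑ p : Fin N × Fin N, A p.1 p.2 ^ 2) := by
  simp [frob, Matrix.frobenius_norm_def, Fintype.sum_prod_type, Real.sqrt_eq_rpow]

lemma frob_nonneg (A : Matrix (Fin N) (Fin N) ℝ) : 0 ≤ frob A := by
  rw [frob_eq_sqrt]
  positivity

lemma frob_sq (A : Matrix (Fin N) (Fin N) ℝ) :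
    frob A ^ 2 = ∑ p : Fin N × Fin N, A p.1 p.2 ^ 2 := by
  rw [frob_eq_sqrt, Real.sq_sqrt (by positivity)]

lemma frob_zero : frob (0 : Matrix (Fin N) (Fin N) ℝ) = 0 := by
  simp [frob_eq_sqrt]

lemma frob_eq_zero {A : Matrix (Fin N) (Fin N) ℝ} : frob A = 0 ↔ A = 0 := by
  let _ := Matrix.frobeniusNormedAddCommGroup (m := Fin N) (n := Fin N) (α := ℝ)
  exact norm_eq_zero

lemma abs_frob_sub_frob_le (A B : Matrix (Fin N) (Fin N) ℝ) :
    |frob A - frob B| ≤ frob (A - B) := by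
  let _ := Matrix.frobeniusNormedAddCommGroup (m := Fin N) (n := Fin N) (α := ℝ)
  exact abs_norm_sub_norm_le A B

lemma frob_smul (c : ℝ) (A : Matrix (Fin N) (Fin N) ℝ) : frob (c • A) = |c| * frob A := by
  rw [frob_eq_sqrt, frob_eq_sqrt]
  simp only [Matrix.smul_apply, smul_eq_mul, mul_pow]
  rw [← Finset.mul_sum, Real.sqrt_mul (sq_nonneg c), Real.sqrt_sq_eq_abs]

lemma frob_sq_sub_frob_sq (A C : Matrix (Fin N) (Fin N) ℝ) :
    frob A ^ 2 - frob C ^ 2 = 2 * (entrySum C A - entrySum C C) + frob (A - C) ^ 2 := by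
  simp only [frob_sq, entrySum, ← Finset.sum_sub_distrib, Finset.mul_sum, ← Finset.sum_add_distrib]
  refine Finset.sum_congr rfl fun p _ => ?_
  simp only [Matrix.sub_apply]
  ring

/-- An exact expansion in place of differentiating the norm at `C`: the linear term carries the
Gaussian fluctuation, the quadratic one is a remainder. -/
lemma frob_sub_frob {A C : Matrix (Fin N) (Fin N) ℝ} (hC : frob C ≠ 0) :
    frob A - frob C = (entrySum C A - entrySum C C) * (2 / (frob A + frob C)) +
      frob (A - C) ^ 2 / (frob A + frob C) := by
  have h := frob_sq_sub_frob_sq A C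
  have hpos : frob A + frob C ≠ 0 := by
    have := frob_nonneg A
    have := (frob_nonneg C).lt_of_ne' hC
    positivity
  field_simp
  linarith

variable {Ω : Type*} [MeasurableSpace Ω] {P : Measure Ω}

lemma aemeasurable_frob {A : Ω → Matrix (Fin N) (Fin N) ℝ}
    (hA : ∀ i j, AEMeasurable (fun ω => A ω i j) P) : AEMeasurable (fun ω => frob (A ω)) P := by
  simp_rw [frob_eq_sqrt]
  exact (Finset.aemeasurable_fun_sum _ fun p _ => (hA p.1 p.2).pow_const 2).sqrt

lemma aemeasurable_trace {A : Ω → Matrix (Fin N) (Fin N) ℝ}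
    (hA : ∀ i j, AEMeasurable (fun ω => A ω i j) P) : AEMeasurable (fun ω => (A ω).trace) P :=
  Finset.aemeasurable_fun_sum _ fun i _ => hA i i

variable [IsProbabilityMeasure P]

lemma tendstoInMeasure_frob {A : ℕ → Ω → Matrix (Fin N) (Fin N) ℝ} {C : Matrix (Fin N) (Fin N) ℝ}
    (hA : ∀ i j, TendstoInMeasure P (fun n ω => A n ω i j) atTop fun _ => C i j) :
    TendstoInMeasure P (fun n ω => frob (A n ω)) atTop fun _ => frob C := by
  simp_rw [frob_eq_sqrt]
  exact tendstoInMeasure_comp_of_continuousAt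
    (X := fun n ω (p : Fin N × Fin N) => A n ω p.1 p.2) (c := fun p => C p.1 p.2)
    (φ := fun x : Fin N × Fin N → ℝ => √(∑ p, x p ^ 2))
    (tendstoInMeasure_pi fun p => hA p.1 p.2)
    (Continuous.continuousAt (by fun_prop))

lemma tendstoInMeasure_trace {A : ℕ → Ω → Matrix (Fin N) (Fin N) ℝ}
    {C : Matrix (Fin N) (Fin N) ℝ}
    (hA : ∀ i j, TendstoInMeasure P (fun n ω => A n ω i j) atTop fun _ => C i j) :
    TendstoInMeasure P (fun n ω => (A n ω).trace) atTop fun _ => C.trace :=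
  tendstoInMeasure_comp_of_continuousAt
    (X := fun n ω (i : Fin N) => A n ω i i) (c := fun i => C i i)
    (φ := fun x : Fin N → ℝ => ∑ i, x i)
    (tendstoInMeasure_pi fun i => hA i i)
    (Continuous.continuousAt (by fun_prop))

end MatrixStatistics

/-! ### Asymptotics of empirical means of matrix kernels and of their ratios -/

section Kernels

variable {d N : ℕ}

/-- `k` is a square-integrable matrix kernel with mean `C`. -/
structure IsUnbiasedKernel (Q : Measure (Fin d → ℝ))
    (k : (Fin d → ℝ) → (Fin d → ℝ) → Matrix (Fin N) (Fin N) ℝ)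
    (C : Matrix (Fin N) (Fin N) ℝ) : Prop where
  measurable : ∀ i j, Measurable fun p : (Fin d → ℝ) × (Fin d → ℝ) => k p.1 p.2 i j
  memLp : ∀ i j, MemLp (fun p : (Fin d → ℝ) × (Fin d → ℝ) => k p.1 p.2 i j) 2 (Q.prod Q)
  integral_eq : ∀ i j, ∫ p, k p.1 p.2 i j ∂Q.prod Q = C i j

variable {Ω : Type*}

/-- The empirical mean of a matrix kernel over a double sample. -/
def kernelMean (k : (Fin d → ℝ) → (Fin d → ℝ) → Matrix (Fin N) (Fin N) ℝ)
    (S : Fin 2 → ℕ → Ω → Fin d → ℝ) (n : ℕ) (ω : Ω) : Matrix (Fin N) (Fin N) ℝ :=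
  (n : ℝ)⁻¹ • ∑ i ∈ Finset.range n, k (S 0 i ω) (S 1 i ω)

lemma kernelMean_apply (k : (Fin d → ℝ) → (Fin d → ℝ) → Matrix (Fin N) (Fin N) ℝ)
    (S : Fin 2 → ℕ → Ω → Fin d → ℝ) (n : ℕ) (ω : Ω) (i j : Fin N) :
    kernelMean k S n ω i j = pairMean S (fun p => k p.1 p.2 i j) n ω := by
  simp [kernelMean, pairMean, Matrix.sum_apply]

/-- Each limit law needs a single linear functional (`W = 1` for the trace, `W = C` for the norm),
so linearity reduces it to a scalar central limit theorem. -/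
lemma entrySum_kernelMean (k : (Fin d → ℝ) → (Fin d → ℝ) → Matrix (Fin N) (Fin N) ℝ)
    (S : Fin 2 → ℕ → Ω → Fin d → ℝ) (n : ℕ) (ω : Ω) (W : Matrix (Fin N) (Fin N) ℝ) :
    entrySum W (kernelMean k S n ω) = pairMean S (fun p => entrySum W (k p.1 p.2)) n ω := by
  simp only [entrySum, kernelMean_apply, pairMean, Finset.mul_sum]
  rw [Finset.sum_comm]
  refine Finset.sum_congr rfl fun i _ => Finset.sum_congr rfl fun p _ => ?_
  ring

variable [MeasurableSpace Ω] {P : Measure Ω} [IsProbabilityMeasure P]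
  {Q : Measure (Fin d → ℝ)} [IsProbabilityMeasure Q] {S : Fin 2 → ℕ → Ω → Fin d → ℝ}
  {k : (Fin d → ℝ) → (Fin d → ℝ) → Matrix (Fin N) (Fin N) ℝ} {C : Matrix (Fin N) (Fin N) ℝ}

namespace IsUnbiasedKernel

omit [IsProbabilityMeasure Q] in
lemma aemeasurable_kernelMean (hk : IsUnbiasedKernel Q k C) (hS : IsDoubleSample P Q S) (n : ℕ)
    (i j : Fin N) : AEMeasurable (fun ω => kernelMean k S n ω i j) P := by
  simp_rw [kernelMean_apply]
  exact hS.aemeasurable_pairMean (hk.measurable i j) n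

lemma tendsto_kernelMean (hk : IsUnbiasedKernel Q k C) (hS : IsDoubleSample P Q S)
    {m : ℕ → ℕ} (hm : Tendsto m atTop atTop) (i j : Fin N) :
    TendstoInMeasure P (fun n ω => kernelMean k S (m n) ω i j) atTop fun _ => C i j := by
  simp_rw [kernelMean_apply, ← hk.integral_eq i j]
  exact hS.tendsto_pairMean (hk.measurable i j) ((hk.memLp i j).integrable (by norm_num)) hm

omit [IsProbabilityMeasure Q] in
lemma tendsto_mul_kernelMean_sub (hk : IsUnbiasedKernel Q k C) (hS : IsDoubleSample P Q S)
    {m : ℕ → ℕ} (hm : Tendsto m atTop atTop) {q : ℕ → ℝ}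
    (hq : Tendsto (fun n => q n ^ 2 / (m n : ℝ)) atTop (𝓝 0)) (i j : Fin N) :
    TendstoInMeasure P (fun n ω => q n * (kernelMean k S (m n) ω i j - C i j)) atTop
      fun _ => (0 : ℝ) := by
  simp_rw [kernelMean_apply, ← hk.integral_eq i j]
  exact hS.tendsto_mul_pairMean_sub (hk.measurable i j) (hk.memLp i j) hm hq

omit [IsProbabilityMeasure Q] in
-- With `q` inside the norm, this is continuous mapping at the zero matrix. It serves both the
-- denominator and the quadratic remainder of the delta method.
lemma tendsto_frob_smul_kernelMean_sub (hk : IsUnbiasedKernel Q k C) (hS : IsDoubleSample P Q S)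
    {m : ℕ → ℕ} (hm : Tendsto m atTop atTop) {q : ℕ → ℝ}
    (hq : Tendsto (fun n => q n ^ 2 / (m n : ℝ)) atTop (𝓝 0)) :
    TendstoInMeasure P (fun n ω => frob (q n • (kernelMean k S (m n) ω - C))) atTop
      fun _ => (0 : ℝ) := by
  have h := tendstoInMeasure_frob (P := P) (A := fun n ω => q n • (kernelMean k S (m n) ω - C))
    (C := 0) fun i j => hk.tendsto_mul_kernelMean_sub hS hm hq i j
  rwa [frob_zero] at h

omit [IsProbabilityMeasure Q] in
lemma tendsto_mul_frob_sub (hk : IsUnbiasedKernel Q k C) (hS : IsDoubleSample P Q S)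
    {m : ℕ → ℕ} (hm : Tendsto m atTop atTop) {q : ℕ → ℝ}
    (hq : Tendsto (fun n => q n ^ 2 / (m n : ℝ)) atTop (𝓝 0)) :
    TendstoInMeasure P (fun n ω => q n * (frob (kernelMean k S (m n) ω) - frob C)) atTop
      fun _ => (0 : ℝ) := by
  refine tendstoInMeasure_zero_of_abs_le (hk.tendsto_frob_smul_kernelMean_sub hS hm hq)
    fun n ω => ?_
  rw [abs_mul, abs_of_nonneg (frob_nonneg _), frob_smul]
  exact mul_le_mul_of_nonneg_left (abs_frob_sub_frob_le _ _) (abs_nonneg _)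

omit [IsProbabilityMeasure Q] in
lemma tendsto_mul_trace_sub (hk : IsUnbiasedKernel Q k C) (hS : IsDoubleSample P Q S)
    {m : ℕ → ℕ} (hm : Tendsto m atTop atTop) {q : ℕ → ℝ}
    (hq : Tendsto (fun n => q n ^ 2 / (m n : ℝ)) atTop (𝓝 0)) :
    TendstoInMeasure P (fun n ω => q n * ((kernelMean k S (m n) ω).trace - C.trace)) atTop
      fun _ => (0 : ℝ) := by
  have h := tendstoInMeasure_trace (P := P) (A := fun n ω => q n • (kernelMean k S (m n) ω - C))
    (C := 0) fun i j => hk.tendsto_mul_kernelMean_sub hS hm hq i j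
  simpa [Matrix.trace_smul, Matrix.trace_sub] using h

lemma asympNormal_entrySum (hk : IsUnbiasedKernel Q k C) (hS : IsDoubleSample P Q S)
    {m : ℕ → ℕ} (hm : Tendsto m atTop atTop) (W : Matrix (Fin N) (Fin N) ℝ) :
    AsympNormal P
      (fun n ω => √(m n : ℝ) * (entrySum W (kernelMean k S (m n) ω) - entrySum W C))
      Var[fun ω => entrySum W (k (S 0 0 ω) (S 1 0 ω)); P] := by
  have hC : entrySum W C = ∫ p, entrySum W (k p.1 p.2) ∂Q.prod Q := by
    simp only [entrySum, ← hk.integral_eq]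
    rw [integral_finsetSum _ fun p _ =>
      ((hk.memLp p.1 p.2).integrable (by norm_num)).const_mul _]
    simp_rw [integral_const_mul]
  simp_rw [entrySum_kernelMean, hC]
  refine hS.asympNormal_pairMean (φ := fun p => entrySum W (k p.1 p.2)) ?_ ?_ hm
  · exact Finset.measurable_fun_sum _ fun p _ => (hk.measurable p.1 p.2).const_mul _
  · exact memLp_finsetSum _ fun p _ => (hk.memLp p.1 p.2).const_mul _

/-- Delta method for the Frobenius norm of the empirical mean of a kernel. -/
lemma asympNormal_frob (hk : IsUnbiasedKernel Q k C) (hS : IsDoubleSample P Q S)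
    {m : ℕ → ℕ} (hm : Tendsto m atTop atTop) (hC : C ≠ 0) :
    AsympNormal P (fun n ω => √(m n : ℝ) * (frob (kernelMean k S (m n) ω) - frob C))
      (Var[fun ω => entrySum C (k (S 0 0 ω) (S 1 0 ω)); P] / frob C ^ 2) := by
  have hC' : frob C ≠ 0 := fun h => hC (frob_eq_zero.1 h)
  -- The remainder is `√m ‖·‖² = (√√m ‖·‖)²`; the rate `√√m` is slow enough for Chebyshev, since
  -- `(√√m)²/m = 1/√m`.
  have hq : Tendsto (fun n => √(√(m n : ℝ)) ^ 2 / (m n : ℝ)) atTop (𝓝 0) := by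
    have h1 : Tendsto (fun n => (√(m n : ℝ))⁻¹) atTop (𝓝 0) :=
      tendsto_inv_atTop_zero.comp (Real.tendsto_sqrt_atTop.comp
        (tendsto_natCast_atTop_atTop.comp hm))
    refine h1.congr fun n => ?_
    rw [Real.sq_sqrt (Real.sqrt_nonneg _), Real.sqrt_div_self]
  have hfrob : TendstoInMeasure P (fun n ω => frob (kernelMean k S (m n) ω)) atTop
      fun _ => frob C := tendstoInMeasure_frob fun i j => hk.tendsto_kernelMean hS hm i j
  have hfm : ∀ n, AEMeasurable (fun ω => frob (kernelMean k S (m n) ω)) P := fun n =>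
    aemeasurable_frob fun i j => hk.aemeasurable_kernelMean hS (m n) i j
  have hfac : TendstoInMeasure P (fun n ω => 2 / (frob (kernelMean k S (m n) ω) + frob C)) atTop
      fun _ => 2 / (frob C + frob C) :=
    tendstoInMeasure_comp_of_continuousAt (φ := fun x : ℝ => 2 / (x + frob C)) hfrob
      (by fun_prop (disch := simpa using hC'))
  have hrem : TendstoInMeasure P (fun n ω => frob (√(√(m n : ℝ)) • (kernelMean k S (m n) ω - C)) ^ 2
      / (frob (kernelMean k S (m n) ω) + frob C)) atTop fun _ => (0 : ℝ) := by
    have h1 := hk.tendsto_frob_smul_kernelMean_sub hS hm hq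
    have h2 := tendstoInMeasure_mul (tendstoInMeasure_mul h1 h1) hfac
    have h3 := tendstoInMeasure_comp_of_continuousAt (φ := fun x : ℝ => x / 2) h2 (by fun_prop)
    simp only [mul_zero, zero_mul, zero_div] at h3
    refine h3.congr_left fun n => Eventually.of_forall fun ω => ?_
    simp only
    ring
  have key := (hk.asympNormal_entrySum hS hm C).mul_add hfac hrem
    (fun n => ((hfm n).add_const _).const_div _)
    (fun n => ((aemeasurable_frob fun i j =>
      ((hk.aemeasurable_kernelMean hS (m n) i j).sub_const _).const_mul _).pow_const 2).div
        ((hfm n).add_const _))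
  have hv : ∀ v : ℝ, (2 / (frob C + frob C)) ^ 2 * v = v / frob C ^ 2 := fun v => by
    field_simp
    ring
  rw [hv] at key
  refine key.congr fun n => Eventually.of_forall fun ω => ?_
  simp only
  rw [frob_sub_frob hC', frob_smul, mul_pow, sq_abs, Real.sq_sqrt (Real.sqrt_nonneg _)]
  ring

end IsUnbiasedKernel

/-- Consistency and asymptotic normality of the trace and Frobenius ratios. -/
lemma ratio_estimators {s : (Fin d → ℝ) → (Fin d → ℝ) → Matrix (Fin N) (Fin N) ℝ}
    {Sig : Matrix (Fin N) (Fin N) ℝ} {S' : Fin 2 → ℕ → Ω → Fin d → ℝ}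
    (hk : IsUnbiasedKernel Q k C) (hs : IsUnbiasedKernel Q s Sig)
    (hs0 : Sig.trace = 0 → ∀ᵐ p ∂Q.prod Q, s p.1 p.2 = 0)
    (hS : IsDoubleSample P Q S) (hS' : IsDoubleSample P Q S')
    {m M : ℕ → ℕ} (hm : Tendsto m atTop atTop) (hM : Tendsto M atTop atTop) :
    ConvInProb P (fun n ω => ratio1 (kernelMean k S (m n) ω) (kernelMean s S' (M n) ω))
      (ratio1 C Sig) ∧
    ConvInProb P (fun n ω => ratio2 (kernelMean k S (m n) ω) (kernelMean s S' (M n) ω))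
      (ratio2 C Sig) ∧
    (Tendsto (fun n => (m n : ℝ) / (M n : ℝ)) atTop (𝓝 0) →
      AsympNormal P (fun n ω => √(m n : ℝ) *
        (ratio1 (kernelMean k S (m n) ω) (kernelMean s S' (M n) ω) - ratio1 C Sig))
        (Var[fun ω => entrySum 1 (k (S 0 0 ω) (S 1 0 ω)); P] / Sig.trace ^ 2) ∧
      (C ≠ 0 → AsympNormal P (fun n ω => √(m n : ℝ) *
        (ratio2 (kernelMean k S (m n) ω) (kernelMean s S' (M n) ω) - ratio2 C Sig))
        (Var[fun ω => entrySum C (k (S 0 0 ω) (S 1 0 ω)); P] / frob C ^ 2 / frob Sig ^ 2))) := by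
  -- In the degenerate case the estimated covariance is almost surely zero at every sample size, so
  -- the ratios are `x / 0 = 0`.
  have hzero : Sig.trace = 0 → ∀ᵐ ω ∂P, ∀ n, kernelMean s S' n ω = 0 := by
    intro h
    have h1 : ∀ᵐ ω ∂P, ∀ i, s (S' 0 i ω) (S' 1 i ω) = 0 := by
      rw [ae_all_iff]
      intro i
      have hl := hS'.hasLaw_pair i
      have h2 := hs0 h
      rw [← hl.map_eq] at h2
      exact ae_of_ae_map hl.aemeasurable h2
    filter_upwards [h1] with ω hω n
    simp [kernelMean, hω]
  have hA := fun i j => hk.tendsto_kernelMean hS hm i j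
  have hB := fun i j => hs.tendsto_kernelMean hS' hM i j
  have hBm := fun n i j => hs.aemeasurable_kernelMean hS' (M n) i j
  have hconv0 : ∀ {T : ℕ → Ω → ℝ}, (∀ n, T n =ᵐ[P] 0) → ConvInProb P T 0 := fun hT => by
    have h0 : TendstoInMeasure P (fun (_ : ℕ) (_ : Ω) => (0 : ℝ)) atTop fun _ => (0 : ℝ) :=
      tendstoInMeasure_of_tendsto_ae (fun _ => aestronglyMeasurable_const)
        (Eventually.of_forall fun _ => tendsto_const_nhds)
    exact h0.congr_left fun n => (hT n).symm
  have hdeg1 : Sig.trace = 0 → ∀ n, (fun ω =>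
      ratio1 (kernelMean k S (m n) ω) (kernelMean s S' (M n) ω)) =ᵐ[P] 0 := fun h n => by
    filter_upwards [hzero h] with ω hω
    simp [ratio1, hω]
  have hdeg2 : Sig.trace = 0 → ∀ n, (fun ω =>
      ratio2 (kernelMean k S (m n) ω) (kernelMean s S' (M n) ω)) =ᵐ[P] 0 := fun h n => by
    filter_upwards [hzero h] with ω hω
    simp [ratio2, hω, frob_zero]
  have htr : frob Sig = 0 → Sig.trace = 0 := fun h => by simp [frob_eq_zero.1 h]
  refine ⟨?_, ?_, fun hmM => ⟨?_, fun hC => ?_⟩⟩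
  · by_cases h : Sig.trace = 0
    · simpa [ratio1, h] using hconv0 (hdeg1 h)
    · exact tendstoInMeasure_div h (tendstoInMeasure_trace hA) (tendstoInMeasure_trace hB)
  · by_cases h : frob Sig = 0
    · simpa [ratio2, h] using hconv0 (hdeg2 (htr h))
    · exact tendstoInMeasure_div h (tendstoInMeasure_frob hA) (tendstoInMeasure_frob hB)
  -- With `q = √m`, the Chebyshev condition `q²/M → 0` on the denominator is `m/M → 0`.
  all_goals
    have hq : Tendsto (fun n => √(m n : ℝ) ^ 2 / (M n : ℝ)) atTop (𝓝 0) := by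
      simpa [Real.sq_sqrt] using hmM
  · by_cases h : Sig.trace = 0
    · simp only [h, ratio1, div_zero, sub_zero, ne_eq, OfNat.ofNat_ne_zero, not_false_eq_true,
        zero_pow]
      refine asympNormal_zero_of_ae_eq_zero fun n => ?_
      filter_upwards [hdeg1 h n] with ω hω
      simp only [ratio1] at hω
      simp [hω]
    · refine AsympNormal.div h ?_ (tendstoInMeasure_trace hB)
        (hs.tendsto_mul_trace_sub hS' hM hq) fun n => aemeasurable_trace (hBm n)
      simpa only [entrySum_one] using hk.asympNormal_entrySum hS hm 1
  · by_cases h : frob Sig = 0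
    · simp only [h, ratio2, div_zero, sub_zero, ne_eq, OfNat.ofNat_ne_zero, not_false_eq_true,
        zero_pow]
      refine asympNormal_zero_of_ae_eq_zero fun n => ?_
      filter_upwards [hdeg2 (htr h) n] with ω hω
      simp only [ratio2] at hω
      simp [hω]
    · exact AsympNormal.div h (hk.asympNormal_frob hS hm hC) (tendstoInMeasure_frob hB)
        (hs.tendsto_mul_frob_sub hS' hM hq) fun n => aemeasurable_frob (hBm n)

end Kernels

/-! ### Exchanging coordinates between two independent copies -/

section Exchange

variable {d : ℕ} (u : Finset (Fin d))

lemma measurable_piecewise_prod :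
    Measurable fun p : (Fin d → ℝ) × (Fin d → ℝ) => u.piecewise p.1 p.2 := by
  refine measurable_pi_lambda _ fun i => ?_
  by_cases h : i ∈ u <;> simp only [Finset.piecewise, h, if_true, if_false] <;> fun_prop

variable (q : Fin d → Measure ℝ) [∀ i, IsProbabilityMeasure (q i)]

/-- Exchanging the coordinates outside `u` of two independent copies preserves their law. -/
lemma measurePreserving_exchange :
    MeasurePreserving (fun p : (Fin d → ℝ) × (Fin d → ℝ) =>
        (u.piecewise p.1 p.2, u.piecewise p.2 p.1))
      ((Measure.pi q).prod (Measure.pi q)) ((Measure.pi q).prod (Measure.pi q)) := by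
  -- Seen as a vector of pairs, the exchange acts on each coordinate by the identity or by a swap,
  -- and both preserve `q i ⊗ q i`.
  have h1 := measurePreserving_arrowProdEquivProdArrow ℝ ℝ (Fin d) q q
  have h2 : MeasurePreserving
      (fun (x : Fin d → ℝ × ℝ) i => (if i ∈ u then id else Prod.swap : ℝ × ℝ → ℝ × ℝ) (x i))
      (Measure.pi fun i => (q i).prod (q i)) (Measure.pi fun i => (q i).prod (q i)) := by
    refine measurePreserving_pi _ _ fun i => ?_
    split_ifs
    · exact MeasurePreserving.id _
    · exact Measure.measurePreserving_swap
  convert! h1.comp (h2.comp (h1.symm _)) using 1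
  ext p i <;> by_cases h : i ∈ u <;>
    simp [h, MeasurableEquiv.arrowProdEquivProdArrow, Equiv.arrowProdEquivProdArrow]

lemma measurePreserving_piecewise :
    MeasurePreserving (fun p : (Fin d → ℝ) × (Fin d → ℝ) => u.piecewise p.1 p.2)
      ((Measure.pi q).prod (Measure.pi q)) (Measure.pi q) :=
  measurePreserving_fst.comp (measurePreserving_exchange u q)

lemma measurePreserving_piecewise_swap :
    MeasurePreserving (fun p : (Fin d → ℝ) × (Fin d → ℝ) => u.piecewise p.2 p.1)
      ((Measure.pi q).prod (Measure.pi q)) (Measure.pi q) :=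
  measurePreserving_snd.comp (measurePreserving_exchange u q)

end Exchange

/-! ### Integrating out coordinates, and second moments of differences -/

section Marginal

variable {d : ℕ}

/-- Integrating out the coordinates outside `u`. -/
def partialMean (Q : Measure (Fin d → ℝ)) (u : Finset (Fin d)) (a : (Fin d → ℝ) → ℝ)
    (e : Fin d → ℝ) : ℝ := ∫ e', a (u.piecewise e e') ∂Q

variable {u : Finset (Fin d)} {a b : (Fin d → ℝ) → ℝ}

lemma partialMean_piecewise (Q : Measure (Fin d → ℝ)) (e e' : Fin d → ℝ) :
    partialMean Q u a (u.piecewise e e') = partialMean Q u a e := by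
  simp only [partialMean, Finset.piecewise_piecewise_of_subset_left (Finset.Subset.refl u)]

lemma integral_comp_measurePreserving {α β : Type*} [MeasurableSpace α]
    [MeasurableSpace β] {μ : Measure α} {ν : Measure β} {T : α → β} (h : MeasurePreserving T μ ν)
    {f : β → ℝ} (hf : AEStronglyMeasurable f ν) : ∫ x, f (T x) ∂μ = ∫ y, f y ∂ν := by
  rw [← h.map_eq] at hf ⊢
  exact (integral_map h.measurable.aemeasurable hf).symm

lemma integral_sub_sub_sub {α : Type*} [MeasurableSpace α] {μ : Measure α} {f₁ f₂ f₃ f₄ : α → ℝ}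
    (h₁ : Integrable f₁ μ) (h₂ : Integrable f₂ μ) (h₃ : Integrable f₃ μ) (h₄ : Integrable f₄ μ) :
    ∫ x, (f₁ x - f₂ x - (f₃ x - f₄ x)) ∂μ =
      ∫ x, f₁ x ∂μ - ∫ x, f₂ x ∂μ - (∫ x, f₃ x ∂μ - ∫ x, f₄ x ∂μ) := by
  rw [← integral_sub h₁ h₂, ← integral_sub h₃ h₄]
  exact integral_sub (h₁.sub h₂) (h₃.sub h₄)

variable (q : Fin d → Measure ℝ) [∀ i, IsProbabilityMeasure (q i)]

/-- The coordinates in `u` as a sub-σ-algebra. -/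
abbrev coordSigma (u : Finset (Fin d)) : MeasurableSpace (Fin d → ℝ) :=
  MeasurableSpace.comap (fun (x : Fin d → ℝ) (i : u) => x i.1) inferInstance

lemma coordSigma_le : coordSigma u ≤ MeasurableSpace.pi := by
  rw [← measurable_iff_comap_le]
  fun_prop

/-- The partial mean factors through the restriction to `u`, by a function measurable by Fubini. -/
lemma stronglyMeasurable_partialMean (ha : Measurable a) :
    StronglyMeasurable[coordSigma u] (partialMean (Measure.pi q) u a) := by
  have hm : Measurable fun p : (u → ℝ) × (Fin d → ℝ) =>
      a (fun i => if h : i ∈ u then p.1 ⟨i, h⟩ else p.2 i) := by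
    refine ha.comp (measurable_pi_lambda _ fun i => ?_)
    by_cases h : i ∈ u <;> simp only [h, dite_true, dite_false] <;> fun_prop
  have h1 : StronglyMeasurable fun y : u → ℝ =>
      ∫ e', a (fun i => if h : i ∈ u then y ⟨i, h⟩ else e' i) ∂(Measure.pi q) :=
    StronglyMeasurable.integral_prod_right' hm.stronglyMeasurable
  exact h1.comp_measurable (comap_measurable fun (x : Fin d → ℝ) (i : u) => x i.1)

lemma integral_piecewise_mul
    (hi : Integrable (fun p : (Fin d → ℝ) × (Fin d → ℝ) => b p.1 * a (u.piecewise p.1 p.2))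
      ((Measure.pi q).prod (Measure.pi q))) :
    ∫ p, b p.1 * a (u.piecewise p.1 p.2) ∂(Measure.pi q).prod (Measure.pi q) = ∫ e, b e *
      partialMean (Measure.pi q) u a e ∂(Measure.pi q) := by
  rw [integral_prod _ hi]
  simp only [integral_const_mul, partialMean]

lemma integrable_piecewise (ha : Integrable a (Measure.pi q)) :
    Integrable (fun p : (Fin d → ℝ) × (Fin d → ℝ) => a (u.piecewise p.1 p.2))
      ((Measure.pi q).prod (Measure.pi q)) :=
  (measurePreserving_piecewise u q).integrable_comp_of_integrable ha

lemma integrable_partialMean (ha : Integrable a (Measure.pi q)) : Integrable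
    (partialMean (Measure.pi q) u a) (Measure.pi q) :=
  (integrable_piecewise q ha).integral_prod_left

lemma integral_partialMean (ha : Integrable a (Measure.pi q)) :
    ∫ e, partialMean (Measure.pi q) u a e ∂(Measure.pi q) = ∫ e, a e ∂(Measure.pi q) := by
  have h := integral_prod _ (integrable_piecewise (u := u) q ha)
  rw [integral_comp_measurePreserving (measurePreserving_piecewise u q)
    ha.aestronglyMeasurable] at h
  exact h.symm

/-- For independent coordinates, conditioning on the coordinates in `u` is integrating out the
others. -/
lemma partialMean_ae_eq_condExp (ha : Measurable a) (hai : Integrable a (Measure.pi q)) :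
    partialMean (Measure.pi q) u a =ᵐ[(Measure.pi q)] (Measure.pi q)[a | coordSigma u] := by
  refine ae_eq_condExp_of_forall_setIntegral_eq coordSigma_le hai
    (fun s _ _ => (integrable_partialMean q hai).integrableOn) (fun s hs _ => ?_)
    (stronglyMeasurable_partialMean q ha).aestronglyMeasurable
  have hs' : MeasurableSet s := coordSigma_le s hs
  obtain ⟨B, -, rfl⟩ := hs
  set s := (fun (x : Fin d → ℝ) (i : u) => x i.1) ⁻¹' B with hsdef
  -- Redrawing the coordinates outside `u` does not affect membership in `s`, so the set integral is
  -- `integral_partialMean` for the indicator of `s` times `a`.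
  have hmem : ∀ e e' : Fin d → ℝ, u.piecewise e e' ∈ s ↔ e ∈ s := by
    intro e e'
    have : (fun i : u => u.piecewise e e' i.1) = fun i : u => e i.1 := by
      ext i
      simp
    simp only [hsdef, Set.mem_preimage, this]
  have h1 := integral_partialMean (u := u) q (hai.indicator hs')
  rw [integral_indicator hs'] at h1
  rw [← h1, ← integral_indicator hs']
  congr 1
  ext e
  by_cases h : e ∈ s <;> simp [partialMean, Set.indicator, hmem, h]

/-- Conditional expectation preserves `L²`. -/
lemma memLp_partialMean (ha : Measurable a) (ha2 : MemLp a 2 (Measure.pi q)) : MemLp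
    (partialMean (Measure.pi q) u a) 2 (Measure.pi q) :=
  (ha2.condExp (by norm_num)).ae_eq
    (partialMean_ae_eq_condExp q ha (ha2.integrable (by norm_num))).symm

/-- Integrate out the coordinates outside `u` first: the partial mean of `a` does not depend on them
and comes out of the integral. -/
lemma integral_mul_partialMean (ha : Measurable a) (ha2 : MemLp a 2 (Measure.pi q))
    (hb2 : MemLp b 2 (Measure.pi q)) :
    ∫ e, b e * partialMean (Measure.pi q) u a e ∂(Measure.pi q) = ∫ e, partialMean
      (Measure.pi q) u b e * partialMean (Measure.pi q) u a e ∂(Measure.pi q) := by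
  have hi : Integrable (fun e => b e * partialMean (Measure.pi q) u a e) (Measure.pi q) :=
    hb2.integrable_mul (memLp_partialMean q ha ha2)
  rw [← integral_partialMean (u := u) q hi]
  congr 1
  ext e
  simp only [partialMean.eq_1 _ _ (fun e => b e * partialMean (Measure.pi q) u a e),
    partialMean_piecewise,
    integral_mul_const]
  rw [partialMean.eq_1 _ _ b]

lemma memLp_comp_fst {r : ENNReal} (ha2 : MemLp a r (Measure.pi q)) :
    MemLp (fun p : (Fin d → ℝ) × (Fin d → ℝ) => a p.1) r ((Measure.pi q).prod (Measure.pi q)) :=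
  ha2.comp_measurePreserving measurePreserving_fst

lemma memLp_comp_snd {r : ENNReal} (ha2 : MemLp a r (Measure.pi q)) :
    MemLp (fun p : (Fin d → ℝ) × (Fin d → ℝ) => a p.2) r ((Measure.pi q).prod (Measure.pi q)) :=
  ha2.comp_measurePreserving measurePreserving_snd

lemma memLp_comp_piecewise {r : ENNReal} (ha2 : MemLp a r (Measure.pi q)) :
    MemLp (fun p : (Fin d → ℝ) × (Fin d → ℝ) => a (u.piecewise p.1 p.2)) r
      ((Measure.pi q).prod (Measure.pi q)) :=
  ha2.comp_measurePreserving (measurePreserving_piecewise u q)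

lemma memLp_comp_piecewise_swap {r : ENNReal} (ha2 : MemLp a r (Measure.pi q)) :
    MemLp (fun p : (Fin d → ℝ) × (Fin d → ℝ) => a (u.piecewise p.2 p.1)) r
      ((Measure.pi q).prod (Measure.pi q)) :=
  ha2.comp_measurePreserving (measurePreserving_piecewise_swap u q)

/-- The two exchanged vectors are independent, so the expectation factorises. -/
lemma integral_exchange_mul (ha : Measurable a) (hb : Measurable b) :
    ∫ p, a (u.piecewise p.2 p.1) * b (u.piecewise p.1 p.2) ∂(Measure.pi q).prod (Measure.pi q) =
      (∫ e, a e ∂(Measure.pi q)) * ∫ e, b e ∂(Measure.pi q) := by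
  have h := integral_comp_measurePreserving (measurePreserving_exchange u q)
    (f := fun p : (Fin d → ℝ) × (Fin d → ℝ) => b p.1 * a p.2)
    ((hb.comp measurable_fst).mul (ha.comp measurable_snd)).aestronglyMeasurable
  rw [integral_prod_mul] at h
  rw [mul_comm, ← h]
  simp only [mul_comm]

variable (ha : Measurable a) (hb : Measurable b) (ha2 : MemLp a 2 (Measure.pi q))
  (hb2 : MemLp b 2 (Measure.pi q))
include ha hb ha2 hb2

omit ha in
-- The pick-freeze identity: the two arguments share the coordinates in `u` and are independent
-- given them.
lemma integral_fst_mul_piecewise :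
    ∫ p, a p.1 * b (u.piecewise p.1 p.2) ∂(Measure.pi q).prod (Measure.pi q) =
      ∫ e, partialMean (Measure.pi q) u a e * partialMean (Measure.pi q) u b e ∂(Measure.pi q) := by
  rw [integral_piecewise_mul q
    ((memLp_comp_fst q ha2).integrable_mul (memLp_comp_piecewise q hb2)),
    integral_mul_partialMean q hb hb2 ha2]

omit hb in
lemma integral_piecewise_swap_mul_snd :
    ∫ p, a (u.piecewise p.2 p.1) * b p.2 ∂(Measure.pi q).prod (Measure.pi q) =
      ∫ e, partialMean (Measure.pi q) u a e * partialMean (Measure.pi q) u b e ∂(Measure.pi q) := by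
  have h := integral_prod_swap (μ := (Measure.pi q)) (ν := (Measure.pi q))
    (fun p : (Fin d → ℝ) × (Fin d → ℝ) => b p.1 * a (u.piecewise p.1 p.2))
  simp only [Prod.fst_swap, Prod.snd_swap] at h
  simp_rw [mul_comm _ (b _)]
  rw [h, integral_fst_mul_piecewise q ha hb2 ha2]
  simp only [mul_comm]

/-- Of the four products, two are pick-freeze pairs sharing `u` and two involve independent vectors,
which accounts for the factor `2`. -/
lemma integral_diff_mul_diff_fo :
    ∫ p, (a p.1 - a (u.piecewise p.2 p.1)) * (b (u.piecewise p.1 p.2) - b p.2) ∂(Measure.pi q).prod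
      (Measure.pi q) =
      2 * (∫ e, partialMean (Measure.pi q) u a e * partialMean (Measure.pi q) u b e ∂(Measure.pi q)
        - (∫ e, a e ∂(Measure.pi q)) * ∫ e, b e ∂(Measure.pi q)) := by
  have e : ∀ p : (Fin d → ℝ) × (Fin d → ℝ),
      (a p.1 - a (u.piecewise p.2 p.1)) * (b (u.piecewise p.1 p.2) - b p.2) =
      (a p.1 * b (u.piecewise p.1 p.2) - a p.1 * b p.2) -
      (a (u.piecewise p.2 p.1) * b (u.piecewise p.1 p.2) - a (u.piecewise p.2 p.1) * b p.2) :=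
    fun p => by ring
  simp_rw [e]
  have i1 := (memLp_comp_fst q ha2).integrable_mul (memLp_comp_piecewise (u := u) q hb2)
  have i2 := (memLp_comp_fst q ha2).integrable_mul (memLp_comp_snd q hb2)
  have i3 := (memLp_comp_piecewise_swap (u := u) q ha2).integrable_mul
    (memLp_comp_piecewise (u := u) q hb2)
  have i4 := (memLp_comp_piecewise_swap (u := u) q ha2).integrable_mul (memLp_comp_snd q hb2)
  have h := integral_sub_sub_sub i1 i2 i3 i4
  simp only [Pi.mul_apply] at h
  rw [h]
  rw [integral_fst_mul_piecewise q hb ha2 hb2, integral_prod_mul,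
    integral_exchange_mul q ha hb, integral_piecewise_swap_mul_snd q ha ha2 hb2]
  ring

/-- The vector `(e²_u, e¹_{∼u})` shares with `e¹` the coordinates in `uᶜ`, so both cross terms are
pick-freeze pairs for `uᶜ`; each square term gives `𝔼[a b]`. -/
lemma integral_diff_mul_diff_tot :
    ∫ p, (a p.1 - a (u.piecewise p.2 p.1)) * (b p.1 - b (u.piecewise p.2 p.1)) ∂(Measure.pi q).prod
      (Measure.pi q) =
      2 * (∫ e, a e * b e ∂(Measure.pi q)
        - ∫ e, partialMean (Measure.pi q) uᶜ a e * partialMean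
          (Measure.pi q) uᶜ b e ∂(Measure.pi q)) := by
  have e : ∀ p : (Fin d → ℝ) × (Fin d → ℝ),
      (a p.1 - a (u.piecewise p.2 p.1)) * (b p.1 - b (u.piecewise p.2 p.1)) =
      (a p.1 * b p.1 - a p.1 * b (uᶜ.piecewise p.1 p.2)) -
      (b p.1 * a (uᶜ.piecewise p.1 p.2) - a (u.piecewise p.2 p.1) * b (u.piecewise p.2 p.1)) :=
    fun p => by
      rw [Finset.piecewise_compl]
      ring
  simp_rw [e]
  have i1 := (memLp_comp_fst q ha2).integrable_mul (memLp_comp_fst q hb2)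
  have i2 := (memLp_comp_fst q ha2).integrable_mul (memLp_comp_piecewise (u := uᶜ) q hb2)
  have i3 := (memLp_comp_fst q hb2).integrable_mul (memLp_comp_piecewise (u := uᶜ) q ha2)
  have i4 := (memLp_comp_piecewise_swap (u := u) q ha2).integrable_mul
    (memLp_comp_piecewise_swap (u := u) q hb2)
  have h := integral_sub_sub_sub i1 i2 i3 i4
  simp only [Pi.mul_apply] at h
  rw [h]
  have hab : AEStronglyMeasurable (fun e => a e * b e) (Measure.pi q) :=
    (ha.mul hb).aestronglyMeasurable
  rw [integral_fst_mul_piecewise q hb ha2 hb2, integral_fst_mul_piecewise q ha hb2 ha2,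
    integral_comp_measurePreserving measurePreserving_fst hab,
    integral_comp_measurePreserving (measurePreserving_piecewise_swap u q) hab]
  simp_rw [mul_comm (partialMean (Measure.pi q) uᶜ b _)]
  ring

lemma integral_diff_mul_diff_out :
    ∫ p, (a p.1 - a p.2) * (b p.1 - b p.2) ∂(Measure.pi q).prod (Measure.pi q) =
      2 * (∫ e, a e * b e ∂(Measure.pi q) - (∫ e, a e ∂(Measure.pi q)) * ∫ e,
        b e ∂(Measure.pi q)) := by
  have e : ∀ p : (Fin d → ℝ) × (Fin d → ℝ), (a p.1 - a p.2) * (b p.1 - b p.2) =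
      (a p.1 * b p.1 - a p.1 * b p.2) - (b p.1 * a p.2 - a p.2 * b p.2) := fun p => by ring
  simp_rw [e]
  have i1 := (memLp_comp_fst q ha2).integrable_mul (memLp_comp_fst q hb2)
  have i2 := (memLp_comp_fst q ha2).integrable_mul (memLp_comp_snd q hb2)
  have i3 := (memLp_comp_fst q hb2).integrable_mul (memLp_comp_snd q ha2)
  have i4 := (memLp_comp_snd q ha2).integrable_mul (memLp_comp_snd q hb2)
  have h := integral_sub_sub_sub i1 i2 i3 i4
  simp only [Pi.mul_apply] at h
  rw [h]
  have hab : AEStronglyMeasurable (fun e => a e * b e) (Measure.pi q) :=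
    (ha.mul hb).aestronglyMeasurable
  rw [integral_prod_mul, integral_prod_mul,
    integral_comp_measurePreserving measurePreserving_fst hab,
    integral_comp_measurePreserving measurePreserving_snd hab]
  ring

lemma integral_centered_partialMean_mul :
    ∫ e, (partialMean (Measure.pi q) u a e - ∫ e', a e' ∂(Measure.pi q)) *
      (partialMean (Measure.pi q) u b e - ∫ e', b e' ∂(Measure.pi q)) ∂(Measure.pi q) =
      ∫ e, partialMean (Measure.pi q) u a e * partialMean (Measure.pi q) u b e ∂(Measure.pi q) -
        (∫ e, a e ∂(Measure.pi q)) * ∫ e, b e ∂(Measure.pi q) := by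
  have hA := memLp_partialMean (u := u) q ha ha2
  have hB := memLp_partialMean (u := u) q hb hb2
  have hAi := hA.integrable (by norm_num)
  have hBi := hB.integrable (by norm_num)
  have e : ∀ e, (partialMean (Measure.pi q) u a e - ∫ e', a e' ∂(Measure.pi q)) *
    (partialMean (Measure.pi q) u b e - ∫ e', b e' ∂(Measure.pi q)) =
      (partialMean (Measure.pi q) u a e * partialMean (Measure.pi q) u b e - partialMean
        (Measure.pi q) u a e * ∫ e', b e' ∂(Measure.pi q)) -
      ((∫ e', a e' ∂(Measure.pi q)) * partialMean (Measure.pi q) u b e -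
        (∫ e', a e' ∂(Measure.pi q)) * ∫ e', b e' ∂(Measure.pi q)) :=
    fun e => by ring
  simp_rw [e]
  have i1 : Integrable (fun e => partialMean (Measure.pi q) u a e *
      partialMean (Measure.pi q) u b e) (Measure.pi q) := hA.integrable_mul hB
  rw [integral_sub_sub_sub i1 (hAi.mul_const _) (hBi.const_mul _) (integrable_const _),
    integral_mul_const, integral_const_mul, integral_partialMean q (ha2.integrable (by norm_num)),
    integral_partialMean q (hb2.integrable (by norm_num))]
  simp

/-- The partial mean is an orthogonal projection in `L²`, so this is a polarised Pythagoras
identity. -/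
lemma integral_sub_partialMean_mul :
    ∫ e, (a e - partialMean (Measure.pi q) u a e) *
      (b e - partialMean (Measure.pi q) u b e) ∂(Measure.pi q) =
      ∫ e, a e * b e ∂(Measure.pi q) - ∫ e, partialMean (Measure.pi q) u a e * partialMean
        (Measure.pi q) u b e ∂(Measure.pi q) := by
  have hA := memLp_partialMean (u := u) q ha ha2
  have hB := memLp_partialMean (u := u) q hb hb2
  have e : ∀ e, (a e - partialMean (Measure.pi q) u a e) * (b e - partialMean (Measure.pi q) u b e)
    =
      (a e * b e - a e * partialMean (Measure.pi q) u b e) -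
      (b e * partialMean (Measure.pi q) u a e - partialMean (Measure.pi q) u a e * partialMean
        (Measure.pi q) u b e) :=
    fun e => by ring
  simp_rw [e]
  have i1 := ha2.integrable_mul hb2
  have i2 := ha2.integrable_mul hB
  have i3 := hb2.integrable_mul hA
  have i4 := hA.integrable_mul hB
  have h := integral_sub_sub_sub i1 i2 i3 i4
  simp only [Pi.mul_apply] at h
  rw [h]
  rw [integral_mul_partialMean q hb hb2 ha2, integral_mul_partialMean q ha ha2 hb2]
  simp_rw [mul_comm (partialMean (Measure.pi q) u b _)]
  ring

end Marginal

/-! ### Unbiasedness and square integrability of the three kernels -/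

section SensitivityKernels

/-- Hölder with `1/4 + 1/4 = 1/2`: here fourth moments of `g` become second moments of the kernels.
-/
lemma memLp_two_mul {α : Type*} [MeasurableSpace α] {μ : Measure α} {a b : α → ℝ}
    (ha : MemLp a 4 μ) (hb : MemLp b 4 μ) : MemLp (fun x => a x * b x) 2 μ := by
  have : ENNReal.HolderTriple 4 4 2 := ⟨by
    rw [← ENNReal.toReal_eq_toReal_iff' (by simp) (by simp),
      ENNReal.toReal_add (by simp) (by simp)]
    norm_num⟩
  exact hb.mul' ha

variable {d N : ℕ} {u : Finset (Fin d)} {g : (Fin d → ℝ) → EuclideanSpace ℝ (Fin N)}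

lemma measurable_coord (hg : Measurable g) (i : Fin N) : Measurable fun e => g e i :=
  (EuclideanSpace.proj (𝕜 := ℝ) i).continuous.measurable.comp hg

lemma memLp_coord {Q : Measure (Fin d → ℝ)} {r : ENNReal} (hg : MemLp g r Q) (i : Fin N) :
    MemLp (fun e => g e i) r Q :=
  (EuclideanSpace.proj (𝕜 := ℝ) i).comp_memLp' hg

lemma integral_coord {α : Type*} [MeasurableSpace α] {μ : Measure α}
    {h : α → EuclideanSpace ℝ (Fin N)} (hh : Integrable h μ) (i : Fin N) :
    (∫ x, h x ∂μ) i = ∫ x, h x i ∂μ :=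
  ((EuclideanSpace.proj (𝕜 := ℝ) i).integral_comp_comm hh).symm

variable (q : Fin d → Measure ℝ) [∀ i, IsProbabilityMeasure (q i)]

lemma foSF_coord (hg : Measurable g) (hgi : Integrable g (Measure.pi q)) (i : Fin N) :
    (fun e => foSF (Measure.pi q) g u e i) =ᵐ[Measure.pi q] fun e =>
      partialMean (Measure.pi q) u (fun e => g e i) e - ∫ e', g e' i ∂Measure.pi q := by
  have h1 := (EuclideanSpace.proj (𝕜 := ℝ) i).comp_condExp_comm (m := coordSigma u) hgi
  have h2 := partialMean_ae_eq_condExp (u := u) q (measurable_coord hg i)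
    ((EuclideanSpace.proj (𝕜 := ℝ) i).integrable_comp hgi)
  filter_upwards [h1, h2] with e h1 h2
  rw [h2]
  simp only [foSF, PiLp.sub_apply, integral_coord hgi]
  congr 1

/-- Taking a coordinate commutes with the Bochner integral when the section is integrable, which
Fubini grants only for almost every `e`. -/
lemma totSF_coord (hgi : Integrable g (Measure.pi q)) (i : Fin N) :
    (fun e => totSF (Measure.pi q) g u e i) =ᵐ[Measure.pi q] fun e =>
      g e i - partialMean (Measure.pi q) uᶜ (fun e => g e i) e := by
  have h : Integrable (fun p : (Fin d → ℝ) × (Fin d → ℝ) => g (u.piecewise p.2 p.1))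
      ((Measure.pi q).prod (Measure.pi q)) :=
    (measurePreserving_piecewise_swap u q).integrable_comp_of_integrable hgi
  filter_upwards [h.prod_right_ae] with e he
  simp only [totSF, PiLp.sub_apply, integral_coord he, partialMean, Finset.piecewise_compl]

lemma foCov_apply (hg : Measurable g) (hg2 : MemLp g 2 (Measure.pi q)) (i j : Fin N) :
    foCov (Measure.pi q) g u i j =
      ∫ e, partialMean (Measure.pi q) u (fun e => g e i) e *
        partialMean (Measure.pi q) u (fun e => g e j) e ∂Measure.pi q -
      (∫ e, g e i ∂Measure.pi q) * ∫ e, g e j ∂Measure.pi q := by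
  have hgi := hg2.integrable (by norm_num)
  rw [← integral_centered_partialMean_mul q (measurable_coord hg i) (measurable_coord hg j)
    (memLp_coord hg2 i) (memLp_coord hg2 j)]
  refine integral_congr_ae ?_
  filter_upwards [foSF_coord (u := u) q hg hgi i, foSF_coord (u := u) q hg hgi j] with e hi hj
  simp only [outer, Matrix.of_apply, hi, hj]

lemma totCov_apply (hg : Measurable g) (hg2 : MemLp g 2 (Measure.pi q)) (i j : Fin N) :
    totCov (Measure.pi q) g u i j =
      ∫ e, g e i * g e j ∂Measure.pi q -
      ∫ e, partialMean (Measure.pi q) uᶜ (fun e => g e i) e *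
        partialMean (Measure.pi q) uᶜ (fun e => g e j) e ∂Measure.pi q := by
  have hgi := hg2.integrable (by norm_num)
  rw [← integral_sub_partialMean_mul q (measurable_coord hg i) (measurable_coord hg j)
    (memLp_coord hg2 i) (memLp_coord hg2 j)]
  refine integral_congr_ae ?_
  filter_upwards [totSF_coord (u := u) q hgi i, totSF_coord (u := u) q hgi j] with e hi hj
  simp only [outer, Matrix.of_apply, hi, hj]

lemma outCov_apply (hg2 : MemLp g 2 (Measure.pi q)) (i j : Fin N) :
    outCov (Measure.pi q) g i j = ∫ e, g e i * g e j ∂Measure.pi q -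
      (∫ e, g e i ∂Measure.pi q) * ∫ e, g e j ∂Measure.pi q := by
  have hgi := hg2.integrable (by norm_num)
  simp [outCov, matExp, outer, integral_coord hgi]

lemma memLp_diffA (hg4 : MemLp g 4 (Measure.pi q)) (i : Fin N) :
    MemLp (fun p : (Fin d → ℝ) × (Fin d → ℝ) => diffA g u p.1 p.2 i) 4
      ((Measure.pi q).prod (Measure.pi q)) :=
  (memLp_comp_fst q (memLp_coord hg4 i)).sub (memLp_comp_piecewise_swap q (memLp_coord hg4 i))

lemma memLp_diffB (hg4 : MemLp g 4 (Measure.pi q)) (i : Fin N) :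
    MemLp (fun p : (Fin d → ℝ) × (Fin d → ℝ) => diffB g u p.1 p.2 i) 4
      ((Measure.pi q).prod (Measure.pi q)) :=
  (memLp_comp_piecewise q (memLp_coord hg4 i)).sub (memLp_comp_snd q (memLp_coord hg4 i))

lemma measurable_diffA (hg : Measurable g) (i : Fin N) :
    Measurable fun p : (Fin d → ℝ) × (Fin d → ℝ) => diffA g u p.1 p.2 i :=
  ((measurable_coord hg i).comp measurable_fst).sub
    ((measurable_coord hg i).comp ((measurable_piecewise_prod u).comp measurable_swap))

lemma measurable_diffB (hg : Measurable g) (i : Fin N) :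
    Measurable fun p : (Fin d → ℝ) × (Fin d → ℝ) => diffB g u p.1 p.2 i :=
  ((measurable_coord hg i).comp (measurable_piecewise_prod u)).sub
    ((measurable_coord hg i).comp measurable_snd)

/-- `A Bᵀ` and `B Aᵀ` each have mean `2 D_u`, as `D_u` is symmetric; hence the factor `1/4`. -/
lemma isUnbiasedKernel_kerFo (hg : Measurable g) (hg4 : MemLp g 4 (Measure.pi q)) :
    IsUnbiasedKernel (Measure.pi q) (fun e₁ e₂ => (1 / 4 : ℝ) • kerFo g u e₁ e₂)
      (foCov (Measure.pi q) g u) where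
  measurable i j := (((measurable_diffA hg i).mul (measurable_diffB hg j)).add
    ((measurable_diffB hg i).mul (measurable_diffA hg j))).const_mul _
  memLp i j := ((memLp_two_mul (memLp_diffA q hg4 i) (memLp_diffB q hg4 j)).add
    (memLp_two_mul (memLp_diffB q hg4 i) (memLp_diffA q hg4 j))).const_mul _
  integral_eq i j := by
    have hg2 : MemLp g 2 (Measure.pi q) := hg4.mono_exponent (by norm_num)
    have i1 := (memLp_two_mul (memLp_diffA (u := u) q hg4 i)
      (memLp_diffB (u := u) q hg4 j)).integrable
      (by norm_num)
    have i2 := (memLp_two_mul (memLp_diffB (u := u) q hg4 i)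
      (memLp_diffA (u := u) q hg4 j)).integrable
      (by norm_num)
    have h1 := integral_diff_mul_diff_fo (u := u) q (measurable_coord hg i) (measurable_coord hg j)
      (memLp_coord hg2 i) (memLp_coord hg2 j)
    have h2 := integral_diff_mul_diff_fo (u := u) q (measurable_coord hg j) (measurable_coord hg i)
      (memLp_coord hg2 j) (memLp_coord hg2 i)
    simp_rw [mul_comm (partialMean _ u (fun e => g e j) _),
      mul_comm (∫ e, g e j ∂Measure.pi q)] at h2
    rw [foCov_apply q hg hg2]
    simp only [Matrix.smul_apply, smul_eq_mul, kerFo, Matrix.add_apply, outer, Matrix.of_apply]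
    rw [integral_const_mul, integral_add i1 i2]
    simp_rw [mul_comm (diffB g u _ _ i)]
    simp only [diffA, diffB, PiLp.sub_apply]
    rw [h1, h2]
    ring

lemma isUnbiasedKernel_kerTot (hg : Measurable g) (hg4 : MemLp g 4 (Measure.pi q)) :
    IsUnbiasedKernel (Measure.pi q) (fun e₁ e₂ => (1 / 4 : ℝ) • kerTot g u e₁ e₂)
      (totCov (Measure.pi q) g u) where
  measurable i j := (((measurable_diffA hg i).mul (measurable_diffA hg j)).add
    ((measurable_diffB hg i).mul (measurable_diffB hg j))).const_mul _
  memLp i j := ((memLp_two_mul (memLp_diffA q hg4 i) (memLp_diffA q hg4 j)).add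
    (memLp_two_mul (memLp_diffB q hg4 i) (memLp_diffB q hg4 j))).const_mul _
  integral_eq i j := by
    have hg2 : MemLp g 2 (Measure.pi q) := hg4.mono_exponent (by norm_num)
    have i1 := (memLp_two_mul (memLp_diffA (u := u) q hg4 i)
      (memLp_diffA (u := u) q hg4 j)).integrable
      (by norm_num)
    have i2 := (memLp_two_mul (memLp_diffB (u := u) q hg4 i)
      (memLp_diffB (u := u) q hg4 j)).integrable
      (by norm_num)
    have h1 := integral_diff_mul_diff_tot (u := u) q (measurable_coord hg i) (measurable_coord hg j)
      (memLp_coord hg2 i) (memLp_coord hg2 j)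
    -- Swapping the two copies turns `diffB` into `-diffA`, and the signs cancel in the product.
    have hswap : ∫ p, diffB g u p.1 p.2 i * diffB g u p.1 p.2 j
        ∂(Measure.pi q).prod (Measure.pi q) =
        ∫ p, diffA g u p.1 p.2 i * diffA g u p.1 p.2 j ∂(Measure.pi q).prod (Measure.pi q) := by
      rw [← integral_prod_swap]
      congr 1
      ext p
      simp only [diffA, diffB, PiLp.sub_apply, Prod.fst_swap, Prod.snd_swap]
      ring
    rw [totCov_apply q hg hg2]
    simp only [Matrix.smul_apply, smul_eq_mul, kerTot, Matrix.add_apply, outer, Matrix.of_apply]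
    rw [integral_const_mul, integral_add i1 i2, hswap]
    simp only [diffA, PiLp.sub_apply]
    rw [h1]
    ring

lemma isUnbiasedKernel_outer_sub (hg : Measurable g) (hg4 : MemLp g 4 (Measure.pi q)) :
    IsUnbiasedKernel (Measure.pi q)
      (fun e₁ e₂ => (1 / 2 : ℝ) • outer (g e₁ - g e₂) (g e₁ - g e₂))
      (outCov (Measure.pi q) g) where
  measurable i j := by
    have h : ∀ i, Measurable fun p : (Fin d → ℝ) × (Fin d → ℝ) => g p.1 i - g p.2 i := fun i =>
      ((measurable_coord hg i).comp measurable_fst).sub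
        ((measurable_coord hg i).comp measurable_snd)
    exact ((h i).mul (h j)).const_mul _
  memLp i j := by
    have h : ∀ i, MemLp (fun p : (Fin d → ℝ) × (Fin d → ℝ) => g p.1 i - g p.2 i) 4
        ((Measure.pi q).prod (Measure.pi q)) := fun i =>
      (memLp_comp_fst q (memLp_coord hg4 i)).sub (memLp_comp_snd q (memLp_coord hg4 i))
    exact (memLp_two_mul (h i) (h j)).const_mul _
  integral_eq i j := by
    have hg2 : MemLp g 2 (Measure.pi q) := hg4.mono_exponent (by norm_num)
    simp only [Matrix.smul_apply, smul_eq_mul, outer, Matrix.of_apply, PiLp.sub_apply]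
    rw [integral_const_mul, integral_diff_mul_diff_out q (measurable_coord hg i)
      (measurable_coord hg j) (memLp_coord hg2 i) (memLp_coord hg2 j), outCov_apply q hg2]
    ring

/-- An output of zero total variance is almost surely constant. -/
lemma outer_sub_ae_eq_zero_of_trace_outCov (hg : Measurable g) (hg4 : MemLp g 4 (Measure.pi q))
    (h : (outCov (Measure.pi q) g).trace = 0) :
    ∀ᵐ p ∂(Measure.pi q).prod (Measure.pi q),
      (1 / 2 : ℝ) • outer (g p.1 - g p.2) (g p.1 - g p.2) = 0 := by
  have hk := isUnbiasedKernel_outer_sub q hg hg4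
  have hnn : ∀ i (p : (Fin d → ℝ) × (Fin d → ℝ)),
      0 ≤ ((1 / 2 : ℝ) • outer (g p.1 - g p.2) (g p.1 - g p.2)) i i := fun i p => by
    simp only [Matrix.smul_apply, smul_eq_mul, outer, Matrix.of_apply]
    exact mul_nonneg (by norm_num) (mul_self_nonneg _)
  -- The diagonal entries are means of squares, so a zero trace kills each of them, and then the
  -- squares almost surely.
  have hdiag : ∀ i, outCov (Measure.pi q) g i i = 0 := by
    have hpos : ∀ i ∈ Finset.univ, 0 ≤ outCov (Measure.pi q) g i i := fun i _ => by
      rw [← hk.integral_eq]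
      exact integral_nonneg (hnn i)
    exact fun i => (Finset.sum_eq_zero_iff_of_nonneg hpos).1 h i (Finset.mem_univ i)
  have hae : ∀ᵐ p ∂(Measure.pi q).prod (Measure.pi q), ∀ i,
      ((1 / 2 : ℝ) • outer (g p.1 - g p.2) (g p.1 - g p.2)) i i = 0 := by
    rw [ae_all_iff]
    intro i
    exact (integral_eq_zero_iff_of_nonneg (hnn i) ((hk.memLp i i).integrable (by norm_num))).1
      ((hk.integral_eq i i).trans (hdiag i))
  filter_upwards [hae] with p hp
  have hz : ∀ i, (g p.1 - g p.2) i = 0 := fun i => by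
    have := hp i
    simp only [Matrix.smul_apply, smul_eq_mul, outer, Matrix.of_apply] at this
    exact mul_self_eq_zero.1 (by linarith)
  ext i j
  simp only [Matrix.smul_apply, smul_eq_mul, outer, Matrix.of_apply, hz, Matrix.zero_apply]
  ring

end SensitivityKernels

/-! ### The dependency model reproduces the law of the inputs -/

section Law

variable {d K : ℕ} {O : BlockOrdering d K} {μ : Measure (Fin d → ℝ)}

/-- The laws of the independent variables. -/
def DependencyModel.coordLaw (D : DependencyModel O μ) (i : Fin d) : Measure ℝ :=
  if O.IsRoot i then μ.map (fun x => x i) else D.ν i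

lemma DependencyModel.baseLaw_eq_pi (D : DependencyModel O μ) :
    D.baseLaw = Measure.pi D.coordLaw := rfl

variable [IsProbabilityMeasure μ]

instance (D : DependencyModel O μ) (i : Fin d) : IsProbabilityMeasure (D.coordLaw i) := by
  unfold DependencyModel.coordLaw
  split_ifs
  · exact Measure.isProbabilityMeasure_map (measurable_pi_apply i).aemeasurable
  · exact D.isProb i

omit [IsProbabilityMeasure μ] in
lemma DependencyModel.measurable_complete (D : DependencyModel O μ) :
    Measurable (O.complete D.r) := by
  refine measurable_pi_lambda _ fun i => ?_
  by_cases h : O.IsRoot i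
  · simp only [BlockOrdering.complete, h, if_true]
    fun_prop
  · simp only [BlockOrdering.complete, h, if_false]
    exact (D.measurable_r i).comp (by fun_prop)

/-- Each dependency function reads only coordinates of its own block, so distinct blocks are
functions of disjoint groups of independent variables. -/
lemma DependencyModel.iIndepFun_proj_complete (D : DependencyModel O μ) :
    iIndepFun (fun k e => O.proj k (O.complete D.r e)) D.baseLaw := by
  have h : iIndepFun (fun (i : Fin d) (e : Fin d → ℝ) => e i) (Measure.pi D.coordLaw) :=
    iIndepFun_pi (X := fun _ => id) fun _ => aemeasurable_id
  have hb := iIndepFun_group O.block h fun i => (measurable_pi_apply i).aemeasurable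
  refine hb.comp (fun k y (i : {i : Fin d // O.block i = k}) =>
    if O.IsRoot i.1 then y i else D.r i.1 fun j => y ⟨j.1, j.2.1.trans i.2⟩) fun k => ?_
  refine measurable_pi_lambda _ fun i => ?_
  by_cases h : O.IsRoot i.1
  · simp only [h, if_true]
    fun_prop
  · simp only [h, if_false]
    exact (D.measurable_r i.1).comp (by fun_prop)

omit [IsProbabilityMeasure μ] in
lemma BlockOrdering.measurable_proj (k : Fin (K + 1)) : Measurable (O.proj k) :=
  measurable_pi_lambda _ fun i => measurable_pi_apply i.1

/-- Block `0` consists of roots, left unchanged by `complete`, and there both laws are the product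
of the marginals of `μ`; the other blocks are the defining property of the model. -/
lemma DependencyModel.map_proj_complete (hO : O.BlockIndependent μ) (D : DependencyModel O μ)
    (k : Fin (K + 1)) :
    D.baseLaw.map (fun e => O.proj k (O.complete D.r e)) = μ.map (O.proj k) := by
  rcases eq_or_ne k 0 with rfl | hk
  · have h1 : (fun e => O.proj 0 (O.complete D.r e)) = O.proj 0 := by
      ext e i
      have : O.IsRoot i.1 := Or.inl i.2
      simp [BlockOrdering.proj, BlockOrdering.complete, this]
    have hr : ∀ i : {i : Fin d // O.block i = 0}, D.coordLaw i.1 = μ.map (fun x => x i.1) :=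
      fun i => if_pos (Or.inl i.2)
    have h2 := hO.free.map_fun_eq_pi_map fun i => (measurable_pi_apply i.1).aemeasurable
    have h3 : iIndepFun (fun (i : {i : Fin d // O.block i = 0}) (e : Fin d → ℝ) => e i.1)
        (Measure.pi D.coordLaw) :=
      (iIndepFun_pi (X := fun _ => id) fun _ => aemeasurable_id).precomp
        (g := fun i : {i : Fin d // O.block i = 0} => i.1) Subtype.val_injective
    have h4 := h3.map_fun_eq_pi_map fun i => (measurable_pi_apply i.1).aemeasurable
    have h5 : ∀ i, (Measure.pi D.coordLaw).map (fun e : Fin d → ℝ => e i) = D.coordLaw i :=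
      fun i => (measurePreserving_eval D.coordLaw i).map_eq
    simp only [h5, hr] at h4
    rw [h1]
    exact h4.trans h2.symm
  · exact (D.law k hk).symm

/-- The dependency model reproduces the law of the inputs. -/
lemma DependencyModel.map_complete (hO : O.BlockIndependent μ) (D : DependencyModel O μ) :
    D.baseLaw.map (O.complete D.r) = μ := by
  have : IsProbabilityMeasure D.baseLaw := by
    rw [D.baseLaw_eq_pi]
    infer_instance
  -- After grouping by blocks, both laws are products with equal factors.
  apply (groupCoord O.block ℝ).map_measurableEquiv_injective
  have hm := D.measurable_complete
  have h1 := hO.blocks.map_fun_eq_pi_map fun k => (O.measurable_proj k).aemeasurable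
  have h2 := D.iIndepFun_proj_complete.map_fun_eq_pi_map fun k =>
    ((O.measurable_proj k).comp hm).aemeasurable
  rw [Measure.map_map (groupCoord O.block ℝ).measurable hm]
  exact h2.trans ((congrArg Measure.pi (funext (D.map_proj_complete hO))).trans h1.symm)

end Law

/-! ### Estimators as kernel means, and variances in vectorised form -/

section Variances

variable {Ω : Type*} {d N : ℕ}

lemma foCovEst_eq_kernelMean (g : (Fin d → ℝ) → EuclideanSpace ℝ (Fin N)) (u : Finset (Fin d))
    (S : Fin 2 → ℕ → Ω → Fin d → ℝ) (m : ℕ) (ω : Ω) :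
    foCovEst g u S m ω = kernelMean (fun e₁ e₂ => (1 / 4 : ℝ) • kerFo g u e₁ e₂) S m ω := by
  simp only [foCovEst, kernelMean, ← Finset.smul_sum, smul_smul]
  congr 1
  ring

lemma totCovEst_eq_kernelMean (g : (Fin d → ℝ) → EuclideanSpace ℝ (Fin N)) (u : Finset (Fin d))
    (S : Fin 2 → ℕ → Ω → Fin d → ℝ) (m : ℕ) (ω : Ω) :
    totCovEst g u S m ω = kernelMean (fun e₁ e₂ => (1 / 4 : ℝ) • kerTot g u e₁ e₂) S m ω := by
  simp only [totCovEst, kernelMean, ← Finset.smul_sum, smul_smul]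
  congr 1
  ring

lemma outCovEst_eq_kernelMean (g : (Fin d → ℝ) → EuclideanSpace ℝ (Fin N))
    (S : Fin 2 → ℕ → Ω → Fin d → ℝ) (M : ℕ) (ω : Ω) :
    outCovEst g S M ω =
      kernelMean (fun e₁ e₂ => (1 / 2 : ℝ) • outer (g e₁ - g e₂) (g e₁ - g e₂)) S M ω := by
  simp only [outCovEst, kernelMean, ← Finset.smul_sum, smul_smul]
  congr 1
  ring

lemma entrySum_smul (W A : Matrix (Fin N) (Fin N) ℝ) (c : ℝ) :
    entrySum W (c • A) = c * entrySum W A := by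
  simp only [entrySum, Finset.mul_sum, Matrix.smul_apply, smul_eq_mul]
  exact Finset.sum_congr rfl fun p _ => by ring

/-- `Matrix.vec` stacks columns, so the two indices are transposed; hence the exchange of sums. -/
lemma entrySum_eq_vec (W A : Matrix (Fin N) (Fin N) ℝ) :
    entrySum W A = ∑ p : Fin N × Fin N, W.vec p * A.vec p := by
  simp only [entrySum, Matrix.vec, Fintype.sum_prod_type]
  exact Finset.sum_comm

variable [MeasurableSpace Ω] {P : Measure Ω} [IsProbabilityMeasure P]

lemma variance_entrySum {A : Ω → Matrix (Fin N) (Fin N) ℝ}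
    (hA : ∀ i j, MemLp (fun ω => A ω i j) 2 P) (W : Matrix (Fin N) (Fin N) ℝ) :
    Var[fun ω => entrySum W (A ω); P] = W.vec ⬝ᵥ (varVec P A).mulVec W.vec := by
  have hv : ∀ p : Fin N × Fin N, MemLp (fun ω => W.vec p * (A ω).vec p) 2 P := fun p =>
    (hA p.2 p.1).const_mul _
  have hm : AEMeasurable (fun ω => ∑ p : Fin N × Fin N, W.vec p * (A ω).vec p) P :=
    Finset.aemeasurable_fun_sum _ fun p _ => (hv p).aestronglyMeasurable.aemeasurable
  simp_rw [entrySum_eq_vec]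
  rw [← covariance_self hm, covariance_fun_sum_fun_sum hv hv]
  simp only [dotProduct, Matrix.mulVec, varVec, Matrix.of_apply, Finset.mul_sum]
  refine Finset.sum_congr rfl fun p _ => Finset.sum_congr rfl fun p' _ => ?_
  rw [covariance_const_mul_left, covariance_const_mul_right]
  ring

end Variances

/-! ### Assembly of both types of estimators -/

section RatioEstimators

variable {Ω : Type*} [MeasurableSpace Ω] {P : Measure Ω} [IsProbabilityMeasure P] {d N : ℕ}
  {q : Fin d → Measure ℝ} [∀ i, IsProbabilityMeasure (q i)]

/-- The conclusions on the estimators of both types, for a kernel `k` with mean `4 C`. -/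
lemma sensitivity_estimators {g : (Fin d → ℝ) → EuclideanSpace ℝ (Fin N)} (hg : Measurable g)
    (hg4 : MemLp g 4 (Measure.pi q))
    {k : (Fin d → ℝ) → (Fin d → ℝ) → Matrix (Fin N) (Fin N) ℝ} {C : Matrix (Fin N) (Fin N) ℝ}
    (hk : IsUnbiasedKernel (Measure.pi q) (fun e₁ e₂ => (1 / 4 : ℝ) • k e₁ e₂) C)
    {est : ℕ → Ω → Matrix (Fin N) (Fin N) ℝ} {S S' : Fin 2 → ℕ → Ω → Fin d → ℝ}
    (hest : ∀ m ω, est m ω = kernelMean (fun e₁ e₂ => (1 / 4 : ℝ) • k e₁ e₂) S m ω)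
    (hS : IsDoubleSample P (Measure.pi q) S) (hS' : IsDoubleSample P (Measure.pi q) S')
    {m M : ℕ → ℕ} (hm : Tendsto m atTop atTop) (hM : Tendsto M atTop atTop) :
    ConvInProb P (fun n ω => ratio1 (est (m n) ω) (outCovEst g S' (M n) ω))
      (ratio1 C (outCov (Measure.pi q) g)) ∧
    ConvInProb P (fun n ω => ratio2 (est (m n) ω) (outCovEst g S' (M n) ω))
      (ratio2 C (outCov (Measure.pi q) g)) ∧
    (Tendsto (fun n => (m n : ℝ) / (M n : ℝ)) atTop (𝓝 0) →
      AsympNormal P (fun n ω => √(m n : ℝ) *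
          (ratio1 (est (m n) ω) (outCovEst g S' (M n) ω) - ratio1 C (outCov (Measure.pi q) g)))
        (Var[fun ω => (k (S 0 0 ω) (S 1 0 ω)).trace; P] /
          (16 * (outCov (Measure.pi q) g).trace ^ 2)) ∧
      (C ≠ 0 → AsympNormal P (fun n ω => √(m n : ℝ) *
          (ratio2 (est (m n) ω) (outCovEst g S' (M n) ω) - ratio2 C (outCov (Measure.pi q) g)))
        ((C.vec ⬝ᵥ (varVec P fun ω => k (S 0 0 ω) (S 1 0 ω)).mulVec C.vec) /
          (16 * frob C ^ 2 * frob (outCov (Measure.pi q) g) ^ 2)))) := by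
  have h := ratio_estimators hk (isUnbiasedKernel_outer_sub q hg hg4)
    (outer_sub_ae_eq_zero_of_trace_outCov q hg hg4) hS hS' hm hM
  have hL : ∀ i j, MemLp (fun ω => k (S 0 0 ω) (S 1 0 ω) i j) 2 P := fun i j => by
    have h2 := (hS.memLp_comp (hk.memLp i j) 0).const_mul 4
    simpa [← mul_assoc] using h2
  -- The factor `1/4` of the kernel leaves the variance squared: this is the `16` in the limit
  -- variances.
  simp only [← hest, ← outCovEst_eq_kernelMean, entrySum_smul, variance_const_mul] at h
  obtain ⟨h1, h2, h3⟩ := h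
  refine ⟨h1, h2, fun hmM => ⟨?_, fun hC => ?_⟩⟩
  · convert (h3 hmM).1 using 1
    simp only [entrySum_one]
    ring
  · convert (h3 hmM).2 hC using 1
    rw [variance_entrySum hL]
    ring

end RatioEstimators

end DepGSI

end

open DepGSI in
theorem theorem3 {Ω : Type*} [MeasurableSpace Ω] (P : Measure Ω) [IsProbabilityMeasure P]
    {d K N : ℕ}
    -- the law of the inputs, their blocks, and a dependency model adapted to `u`
    (μ : Measure (Fin d → ℝ)) [IsProbabilityMeasure μ]
    (O : BlockOrdering d K) (hO : O.BlockIndependent μ)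
    (u : Finset (Fin d)) (hu : O.Adapted u)
    (D : DependencyModel O μ)
    -- the model, with its moment conditions
    (f : (Fin d → ℝ) → EuclideanSpace ℝ (Fin N)) (hf : Measurable f)
    (hA2 : MemLp f 2 μ ∧ 0 < ∫ x, ‖f x‖ ^ 2 ∂μ)
    (hA3 : MemLp f 4 μ)
    -- the samples: `S` for the sensitivity covariances, `S'` for the output covariance
    (S S' : Fin 2 → ℕ → Ω → Fin d → ℝ)
    (hS : IsDoubleSample P D.baseLaw S) (hS' : IsDoubleSample P D.baseLaw S')
    -- the sample sizes
    (m M : ℕ → ℕ) (hm : Tendsto m atTop atTop) (hM : Tendsto M atTop atTop) :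
    let g := D.repr f
    let Du := foCov D.baseLaw g u
    let Dtot := totCov D.baseLaw g u
    let Sig := outCov D.baseLaw g
    let Khat : Ω → Matrix (Fin N) (Fin N) ℝ := fun ω => kerFo g u (S 0 0 ω) (S 1 0 ω)
    let Ktot : Ω → Matrix (Fin N) (Fin N) ℝ := fun ω => kerTot g u (S 0 0 ω) (S 1 0 ω)
    let est1 : ℕ → Ω → ℝ := fun n ω =>
      ratio1 (foCovEst g u S (m n) ω) (outCovEst g S' (M n) ω)
    let estT1 : ℕ → Ω → ℝ := fun n ω =>
      ratio1 (totCovEst g u S (m n) ω) (outCovEst g S' (M n) ω)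
    let est2 : ℕ → Ω → ℝ := fun n ω =>
      ratio2 (foCovEst g u S (m n) ω) (outCovEst g S' (M n) ω)
    let estT2 : ℕ → Ω → ℝ := fun n ω =>
      ratio2 (totCovEst g u S (m n) ω) (outCovEst g S' (M n) ω)
    -- consistency
    (ConvInProb P est1 (ratio1 Du Sig) ∧ ConvInProb P estT1 (ratio1 Dtot Sig)) ∧
    (ConvInProb P est2 (ratio2 Du Sig) ∧ ConvInProb P estT2 (ratio2 Dtot Sig)) ∧
    -- asymptotic normality
    (Tendsto (fun n => (m n : ℝ) / (M n : ℝ)) atTop (𝓝 0) →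
      (AsympNormal P (fun n ω => √(m n : ℝ) * (est1 n ω - ratio1 Du Sig))
          (Var[fun ω => (Khat ω).trace; P] / (16 * Sig.trace ^ 2)) ∧
        AsympNormal P (fun n ω => √(m n : ℝ) * (estT1 n ω - ratio1 Dtot Sig))
          (Var[fun ω => (Ktot ω).trace; P] / (16 * Sig.trace ^ 2))) ∧
      (Du ≠ 0 →
        AsympNormal P (fun n ω => √(m n : ℝ) * (est2 n ω - ratio2 Du Sig))
          ((Du.vec ⬝ᵥ (varVec P Khat).mulVec Du.vec) / (16 * frob Du ^ 2 * frob Sig ^ 2))) ∧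
      (Dtot ≠ 0 →
        AsympNormal P (fun n ω => √(m n : ℝ) * (estT2 n ω - ratio2 Dtot Sig))
          ((Dtot.vec ⬝ᵥ (varVec P Ktot).mulVec Dtot.vec) /
            (16 * frob Dtot ^ 2 * frob Sig ^ 2)))) := by
  intro g Du Dtot Sig Khat Ktot est1 estT1 est2 estT2
  have hmap := D.map_complete hO
  have hg : Measurable g := hf.comp D.measurable_complete
  -- Equality of the laws of `g(E)` and `f(X)` transfers the fourth moment.
  have hg4 : MemLp g 4 (Measure.pi D.coordLaw) := by
    refine MemLp.comp_of_map ?_ D.measurable_complete.aemeasurable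
    rw [← D.baseLaw_eq_pi, hmap]
    exact hA3
  obtain ⟨f1, f2, f3⟩ := sensitivity_estimators hg hg4
    (isUnbiasedKernel_kerFo (u := u) D.coordLaw hg hg4) (foCovEst_eq_kernelMean g u S)
    hS hS' hm hM
  obtain ⟨t1, t2, t3⟩ := sensitivity_estimators hg hg4
    (isUnbiasedKernel_kerTot (u := u) D.coordLaw hg hg4) (totCovEst_eq_kernelMean g u S)
    hS hS' hm hM
  exact ⟨⟨f1, t1⟩, ⟨f2, t2⟩, fun hmM =>
    ⟨⟨(f3 hmM).1, (t3 hmM).1⟩, (f3 hmM).2, (t3 hmM).2⟩⟩
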